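/- Let $k$ be an algebraically closed field of characteristic $p\ge 5$, and let $X,Y$ be homogeneous coordinates on $\mathbb{P}^1=\mathbb{P}^1_k$. For homogeneous polynomials $f_1,\dots,f_n\in k[X,Y]$ of degrees $d_1,\dots,d_n$ with no common zero on $\mathbb{P}^1$, let $\mathrm{Syz}_{\mathbb{P}^1}(f_1,\dots,f_n)$ be the vector bundle of rank $n-1$ defined by the exact sequence $$0\to \mathrm{Syz}_{\mathbb{P}^1}(f_1,\dots,f_n)\to\bigoplus_{i=1}^n\mathcal{O}(-d_i)\xrightarrow{\ (\tau_i)\mapsto\sum_i\tau_if_i\ }\mathcal{O}_{\mathbb{P}^1}\to 0.$$ Set $$\mathcal{S}_\pm:=\mathrm{Syz}_{\mathbb{P}^1}\bigl(X^{3p},\,X^{2p}Y^p,\,X^pY^{2p},\,Y^{3p},\,(X^6+Y^6)^{\frac{p\pm1}{2}}\bigr).$$ Then: (i) If $p\equiv 1 \pmod 8$, then $\mathcal{S}_+\simeq \mathcal{O}(\frac{-15p-9}{4})\oplus\mathcal{O}(\frac{-15p-1}{4})^{\oplus 3}$ and $\mathcal{S}_-\simeq \mathcal{O}(\frac{-15p+3}{4})^{\oplus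 4}$. (ii) If $p\equiv -1 \pmod 8$, then $\mathcal{S}_+\simeq \mathcal{O}(\frac{-15p-3}{4})^{\oplus 4}$ and $\mathcal{S}_-\simeq \mathcal{O}(\frac{-15p+1}{4})^{\oplus 3}\oplus\mathcal{O}(\frac{-15p+9}{4})$. (iii) If $p\equiv 3 \pmod 8$, then $\mathcal{S}_+\simeq \mathcal{O}(\frac{-15p-7}{4})^{\oplus 2}\oplus\mathcal{O}(\frac{-15p+1}{4})^{\oplus 2}$ and $\mathcal{S}_-\simeq \mathcal{O}(\frac{-15p-3}{4})\oplus\mathcal{O}(\frac{-15p+5}{4})^{\oplus 3}$. (iv) If $p\equiv -3 \pmod 8$, then $\mathcal{S}_+\simeq \mathcal{O}(\frac{-15p-5}{4})^{\oplus 3}\oplus\mathcal{O}(\frac{-15p+3}{4})$ and $\mathcal{S}_-\simeq \mathcal{O}(\frac{-15p-1}{4})^{\oplus 2}\oplus\mathcal{O}(\frac{-15p+7}{4})^{\oplus 2}$. -/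

import Mathlib

open CategoryTheory Opposite TopologicalSpace AlgebraicGeometry

namespace ProjTwist

universe u

variable {A : Type u} {σ : Type*} [CommRing A] [SetLike σ A] [AddSubgroupClass σ A]
variable (𝒜 : ℕ → σ) [GradedRing 𝒜]

/-- The complement of the homogeneous prime ideal of a point `x` of `Proj 𝒜`. -/
abbrev compl (x : ProjectiveSpectrum 𝒜) : Submonoid A :=
  x.asHomogeneousIdeal.toIdeal.primeCompl

/-- The localization of the ring at the homogeneous prime ideal of a point `x` of `Proj 𝒜`. -/
abbrev Loc (x : ProjectiveSpectrum 𝒜) : Type u :=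
  Localization (compl 𝒜 x)

/-- A function `s` on `U`, with values in the localizations at the points of `U`, is a homogeneous
fraction of degree `n` if it is `a / b` on all of `U`, where `a`, `b` are homogeneous, `b` vanishes
at no point of `U`, and `deg a - deg b = n`. -/
def IsFraction (n : ℤ) {U : Opens (ProjectiveSpectrum.top 𝒜)} (s : ∀ x : U, Loc 𝒜 x.1) : Prop :=
  ∃ (i j : ℕ) (a b : A) (_ : a ∈ 𝒜 i) (_ : b ∈ 𝒜 j) (_ : (i : ℤ) = j + n)
    (hb : ∀ x : U, b ∈ compl 𝒜 x.1),
    ∀ x : U, s x = (Localization.mk a ⟨b, hb x⟩ : Loc 𝒜 x.1)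

/-- Homogeneous fractions of degree `n` restrict to smaller open sets. -/
def isFractionPrelocal (n : ℤ) :
    TopCat.PrelocalPredicate fun x : ProjectiveSpectrum.top 𝒜 => Loc 𝒜 x where
  pred s := IsFraction 𝒜 n s
  res := by
    rintro V U f s ⟨i, j, a, b, ha, hb, hij, hx, h⟩
    exact ⟨i, j, a, b, ha, hb, hij, fun x => hx (f x), fun x => h (f x)⟩

/-- Functions that are, locally, homogeneous fractions of degree `n`. -/
def isLocallyFraction (n : ℤ) :
    TopCat.LocalPredicate fun x : ProjectiveSpectrum.top 𝒜 => Loc 𝒜 x :=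
  (isFractionPrelocal 𝒜 n).sheafify

variable {𝒜}

/-- At every point of `Proj 𝒜` there are denominators of arbitrarily large degree. -/
theorem exists_den (x : ProjectiveSpectrum.top 𝒜) (n : ℤ) :
    ∃ (i j : ℕ) (b : A), b ∈ 𝒜 j ∧ (i : ℤ) = j + n ∧ b ∈ compl 𝒜 x := by
  obtain ⟨f, hf, hfx⟩ := SetLike.not_le_iff_exists.mp x.not_irrelevant_le
  obtain ⟨d, hd⟩ : ∃ d, (DirectSum.decompose 𝒜 f d : A) ∉ x.asHomogeneousIdeal.toIdeal := by
    by_contra! h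
    apply hfx
    classical
    have := DirectSum.sum_support_decompose 𝒜 f
    rw [← this]
    exact Ideal.sum_mem _ fun i _ => h i
  have hd0 : d ≠ 0 := by
    rintro rfl
    apply hd
    have : (DirectSum.decompose 𝒜 f 0 : A) = 0 := by
      simpa [HomogeneousIdeal.mem_irrelevant_iff, GradedRing.proj_apply] using hf
    rw [this]; exact Ideal.zero_mem _
  have hpos : 1 ≤ d := Nat.one_le_iff_ne_zero.mpr hd0
  refine ⟨((n.natAbs * d : ℕ) + n).toNat, n.natAbs * d, (DirectSum.decompose 𝒜 f d : A) ^ n.natAbs,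
    by simpa using SetLike.pow_mem_graded n.natAbs (SetLike.coe_mem (DirectSum.decompose 𝒜 f d)), ?_, ?_⟩
  · have : n.natAbs ≤ n.natAbs * d := Nat.le_mul_of_pos_right _ hpos
    omega
  · intro h
    exact hd (x.isPrime.mem_of_pow_mem _ h)

theorem zero_mem' (n : ℤ) (U : (Opens (ProjectiveSpectrum.top 𝒜))ᵒᵖ) :
    (isLocallyFraction 𝒜 n).pred (0 : ∀ x : U.unop, Loc 𝒜 x.1) := by
  intro x
  obtain ⟨i, j, b, hb, hij, hx⟩ := exists_den x.1 n
  refine ⟨U.unop ⊓ ProjectiveSpectrum.basicOpen 𝒜 b, ⟨x.2, hx⟩, Opens.infLELeft _ _,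
    i, j, 0, b, zero_mem _, hb, hij, fun y => y.2.2, fun y => ?_⟩
  exact (Localization.mk_zero _).symm

theorem add_mem' (n : ℤ) (U : (Opens (ProjectiveSpectrum.top 𝒜))ᵒᵖ)
    (s t : ∀ x : U.unop, Loc 𝒜 x.1) (hs : (isLocallyFraction 𝒜 n).pred s)
    (ht : (isLocallyFraction 𝒜 n).pred t) : (isLocallyFraction 𝒜 n).pred (s + t) := by
  intro x
  obtain ⟨V, hV, f, i, j, a, b, ha, hb, hij, hx, h⟩ := hs x
  obtain ⟨V', hV', f', i', j', a', b', ha', hb', hij', hx', h'⟩ := ht x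
  refine ⟨V ⊓ V', ⟨hV, hV'⟩, Opens.infLELeft _ _ ≫ f, j' + i, j + j', b' * a + b * a', b * b',
    add_mem (SetLike.mul_mem_graded hb' ha) ?_, SetLike.mul_mem_graded hb hb', by push_cast; omega,
    fun y => (compl 𝒜 y.1).mul_mem (hx ⟨y.1, y.2.1⟩) (hx' ⟨y.1, y.2.2⟩),
    fun y => ?_⟩
  · have : j' + i = j + i' := by omega
    rw [this]; exact SetLike.mul_mem_graded hb ha'
  · have e := h ⟨y.1, y.2.1⟩
    have e' := h' ⟨y.1, y.2.2⟩
    refine (congrArg₂ (· + ·) e e').trans ?_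
    rw [Localization.add_mk, add_comm]
    rfl

theorem neg_mem' (n : ℤ) (U : (Opens (ProjectiveSpectrum.top 𝒜))ᵒᵖ)
    (s : ∀ x : U.unop, Loc 𝒜 x.1) (hs : (isLocallyFraction 𝒜 n).pred s) :
    (isLocallyFraction 𝒜 n).pred (-s) := by
  intro x
  obtain ⟨V, hV, f, i, j, a, b, ha, hb, hij, hx, h⟩ := hs x
  refine ⟨V, hV, f, i, j, -a, b, neg_mem ha, hb, hij, hx, fun y => ?_⟩
  exact (congrArg Neg.neg (h y)).trans (Localization.neg_mk _ _)

/-- Degrees add up under multiplication. -/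
theorem mul_mem' {m n l : ℤ} (hl : l = m + n) (U : (Opens (ProjectiveSpectrum.top 𝒜))ᵒᵖ)
    (s t : ∀ x : U.unop, Loc 𝒜 x.1) (hs : (isLocallyFraction 𝒜 m).pred s)
    (ht : (isLocallyFraction 𝒜 n).pred t) : (isLocallyFraction 𝒜 l).pred (s * t) := by
  intro x
  obtain ⟨V, hV, f, i, j, a, b, ha, hb, hij, hx, h⟩ := hs x
  obtain ⟨V', hV', f', i', j', a', b', ha', hb', hij', hx', h'⟩ := ht x
  refine ⟨V ⊓ V', ⟨hV, hV'⟩, Opens.infLELeft _ _ ≫ f, i + i', j + j', a * a', b * b',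
    SetLike.mul_mem_graded ha ha', SetLike.mul_mem_graded hb hb', by push_cast; omega,
    fun y => (compl 𝒜 y.1).mul_mem (hx ⟨y.1, y.2.1⟩) (hx' ⟨y.1, y.2.2⟩),
    fun y => ?_⟩
  have e := h ⟨y.1, y.2.1⟩
  have e' := h' ⟨y.1, y.2.2⟩
  refine (congrArg₂ (· * ·) e e').trans ?_
  rw [Localization.mk_mul]; rfl

theorem val_mem (U : (Opens (ProjectiveSpectrum.top 𝒜))ᵒᵖ)
    (r : (ProjectiveSpectrum.Proj.structureSheaf 𝒜).1.obj U) :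
    (isLocallyFraction 𝒜 0).pred (fun x : U.unop => (r.1 x).val) := by
  intro x
  obtain ⟨V, hV, f, i, a, b, hx, h⟩ := r.2 x
  refine ⟨V, hV, f, i, i, a, b, a.2, b.2, by simp, hx, fun y => ?_⟩
  exact congrArg HomogeneousLocalization.val (h y)

theorem const_mem (U : (Opens (ProjectiveSpectrum.top 𝒜))ᵒᵖ) {d : ℕ} {f : A} (hf : f ∈ 𝒜 d) :
    (isLocallyFraction 𝒜 d).pred (fun x : U.unop => algebraMap A (Loc 𝒜 x.1) f) := by
  intro x
  refine ⟨U.unop, x.2, 𝟙 _, d, 0, f, 1, hf, SetLike.one_mem_graded _, by simp,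
    fun y => (compl 𝒜 y.1).one_mem, fun y => ?_⟩
  exact (Localization.mk_one_eq_algebraMap _).symm

variable (𝒜)

/-- The group of sections of `𝒪(n)` over `U`: the functions on `U` with values in the localizations
at the points of `U` that are, locally, homogeneous fractions of degree `n`. -/
def sections (n : ℤ) (U : (Opens (ProjectiveSpectrum.top 𝒜))ᵒᵖ) :
    AddSubgroup (∀ x : U.unop, Loc 𝒜 x.1) where
  carrier := {s | (isLocallyFraction 𝒜 n).pred s}
  zero_mem' := zero_mem' n U
  add_mem' := add_mem' n U _ _
  neg_mem' := neg_mem' n U _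

/-- Sections of the structure sheaf act on sections of `𝒪(n)` by pointwise multiplication. -/
instance sectionsModule (n : ℤ) (U : (Opens (ProjectiveSpectrum.top 𝒜))ᵒᵖ) :
    Module ((ProjectiveSpectrum.Proj.structureSheaf 𝒜).1.obj U) (sections 𝒜 n U) where
  smul r s := ⟨fun x => (r.1 x).val * s.1 x, mul_mem' (by simp) U _ _ (val_mem U r) s.2⟩
  one_smul s := by
    refine Subtype.ext (funext fun x => ?_)
    exact (congrArg (· * s.1 x) (HomogeneousLocalization.val_one)).trans (one_mul _)
  mul_smul r r' s := by
    refine Subtype.ext (funext fun x => ?_)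
    exact (congrArg (· * s.1 x) (HomogeneousLocalization.val_mul _ _)).trans (mul_assoc _ _ _)
  smul_zero r := Subtype.ext (funext fun _ => mul_zero _)
  smul_add r s t := Subtype.ext (funext fun _ => mul_add _ _ _)
  add_smul r r' s := by
    refine Subtype.ext (funext fun x => ?_)
    exact (congrArg (· * s.1 x) (HomogeneousLocalization.val_add _ _)).trans (add_mul _ _ _)
  zero_smul s := by
    refine Subtype.ext (funext fun x => ?_)
    exact (congrArg (· * s.1 x) (HomogeneousLocalization.val_zero)).trans (zero_mul _)

/-- The underlying presheaf of abelian groups of `𝒪(n)`. -/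
def twistAb (n : ℤ) : (Opens (ProjectiveSpectrum.top 𝒜))ᵒᵖ ⥤ AddCommGrpCat.{u} where
  obj U := AddCommGrpCat.of (sections 𝒜 n U)
  map {U V} f := AddCommGrpCat.ofHom
    { toFun := fun s => ⟨fun x => s.1 (f.unop x), (isLocallyFraction 𝒜 n).res f.unop s.1 s.2⟩
      map_zero' := rfl
      map_add' := fun _ _ => rfl }

theorem twistAb_isSheaf (n : ℤ) : TopCat.Presheaf.IsSheaf (twistAb 𝒜 n) :=
  (TopCat.Presheaf.isSheaf_iff_isSheaf_comp (forget AddCommGrpCat) _).2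
    (TopCat.subsheafToTypes (isLocallyFraction 𝒜 n)).2

/-- Serre's twisting sheaf `𝒪(n)` on `Proj 𝒜`, as a sheaf of modules over the structure sheaf. -/
noncomputable def twist (n : ℤ) : (Proj 𝒜).Modules where
  val :=
    letI (U : (Opens (Proj 𝒜))ᵒᵖ) :
        Module ((Proj 𝒜).ringCatSheaf.obj.obj U) ((twistAb 𝒜 n).obj U) :=
      sectionsModule 𝒜 n U
    .ofPresheaf (twistAb 𝒜 n) fun _ _ _ _ _ => rfl
  isSheaf := twistAb_isSheaf 𝒜 n


variable {𝒜}

/-- Multiplication by a homogeneous element of degree `d`, as a morphism `𝒪(m) ⟶ 𝒪(m + d)`. -/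
noncomputable def mulHom {m n : ℤ} {d : ℕ} (h : n = d + m) {f : A} (hf : f ∈ 𝒜 d) :
    twist 𝒜 m ⟶ twist 𝒜 n :=
  SheafOfModules.Hom.mk <| PresheafOfModules.homMk
    (M₁ := (twist 𝒜 m).val) (M₂ := (twist 𝒜 n).val)
    { app := fun U => AddCommGrpCat.ofHom
        (show sections 𝒜 m U →+ sections 𝒜 n U from
        { toFun := fun s =>
            ⟨fun x => algebraMap A (Loc 𝒜 x.1) f * s.1 x, mul_mem' h U _ _ (const_mem U hf) s.2⟩
          map_zero' := Subtype.ext (funext fun _ => mul_zero _)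
          map_add' := fun _ _ => Subtype.ext (funext fun _ => mul_add _ _ _) })
      naturality := fun _ _ _ => rfl }
    (fun _ _ _ => Subtype.ext (funext fun _ => mul_left_comm _ _ _))

/-- Sheaves of modules on a scheme have finite direct sums. -/
instance hasFiniteBiproductsModules (X : Scheme.{u}) : Limits.HasFiniteBiproducts X.Modules :=
  Abelian.hasFiniteBiproducts

variable (𝒜) in
/-- The structure sheaf of `Proj 𝒜`, as a sheaf of modules over itself. -/
noncomputable def structureModule : (Proj 𝒜).Modules :=
  SheafOfModules.unit (Proj 𝒜).ringCatSheaf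

/-- The canonical morphism from the structure sheaf to `𝒪(0)`. -/
noncomputable def ofUnit : structureModule 𝒜 ⟶ twist 𝒜 0 :=
  SheafOfModules.Hom.mk <| PresheafOfModules.homMk
    (M₁ := (structureModule 𝒜).val) (M₂ := (twist 𝒜 0).val)
    { app := fun U => AddCommGrpCat.ofHom
        (show (ProjectiveSpectrum.Proj.structureSheaf 𝒜).1.obj U →+ sections 𝒜 0 U from
        { toFun := fun s => ⟨fun x => (s.1 x).val, val_mem U s⟩
          map_zero' := Subtype.ext (funext fun _ => HomogeneousLocalization.val_zero)
          map_add' := fun _ _ => Subtype.ext (funext fun _ => HomogeneousLocalization.val_add _ _) })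
      naturality := fun _ _ _ => rfl }
    (fun _ _ _ => Subtype.ext (funext fun _ => HomogeneousLocalization.val_mul _ _))


/-- The structure sheaf is `𝒪(0)`. -/
instance isIso_ofUnit : IsIso (ofUnit (𝒜 := 𝒜)) := by
  rw [Scheme.Modules.Hom.isIso_iff_isIso_app]
  intro U
  rw [ConcreteCategory.isIso_iff_bijective]
  constructor
  · intro r r' h
    refine Subtype.ext (funext fun x => HomogeneousLocalization.val_injective _ ?_)
    exact congrFun (congrArg Subtype.val h) x
  · intro s
    obtain ⟨s, hs⟩ := (show sections 𝒜 0 (op U) from s)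
    have hs' : ∀ x : U, ∃ r : HomogeneousLocalization 𝒜 (compl 𝒜 x.1), r.val = s x := by
      intro x
      obtain ⟨V, hV, f, i, j, a, b, ha, hb, hij, hx, h⟩ := hs x
      obtain rfl : i = j := by omega
      exact ⟨HomogeneousLocalization.mk ⟨i, ⟨a, ha⟩, ⟨b, hb⟩, hx ⟨x.1, hV⟩⟩, (h ⟨x.1, hV⟩).symm⟩
    choose r hr using hs'
    refine ⟨⟨r, ?_⟩, Subtype.ext (funext hr)⟩
    intro x
    obtain ⟨V, hV, f, i, j, a, b, ha, hb, hij, hx, h⟩ := hs x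
    obtain rfl : i = j := by omega
    refine ⟨V, hV, f, i, ⟨a, ha⟩, ⟨b, hb⟩, hx, fun y => HomogeneousLocalization.val_injective _ ?_⟩
    exact (hr _).trans (h y)

/-- The morphism `⨁ᵢ 𝒪(-dᵢ) ⟶ 𝒪` on `Proj 𝒜` that sends `(τᵢ)` to `∑ᵢ τᵢ fᵢ`, where `fᵢ` is
homogeneous of degree `dᵢ`. -/
noncomputable def syzHom {ι : Type} [Finite ι] (d : ι → ℕ) (f : ι → A)
    (hf : ∀ i, f i ∈ 𝒜 (d i)) :
    (Limits.biproduct fun i => twist 𝒜 (-(d i : ℤ))) ⟶ structureModule 𝒜 :=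
  Limits.biproduct.desc fun i =>
    (mulHom (by simp) (hf i) : twist 𝒜 (-(d i : ℤ)) ⟶ twist 𝒜 0) ≫ inv ofUnit

/-- The syzygy sheaf of homogeneous elements `fᵢ` of degrees `dᵢ`: the kernel of
`⨁ᵢ 𝒪(-dᵢ) ⟶ 𝒪`. It is the syzygy bundle when the `fᵢ` have no common zero. -/
noncomputable def syz {ι : Type} [Finite ι] (d : ι → ℕ) (f : ι → A)
    (hf : ∀ i, f i ∈ 𝒜 (d i)) : (Proj 𝒜).Modules :=
  Limits.kernel (syzHom d f hf)

/-- The polynomial ring `k[X, Y]` graded by degree. -/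
abbrev polyGrading (k : Type u) [Field k] : ℕ → Submodule k (MvPolynomial (Fin 2) k) :=
  MvPolynomial.homogeneousSubmodule (Fin 2) k

noncomputable instance gradedRingPolyGrading (k : Type u) [Field k] : GradedRing (polyGrading k) :=
  MvPolynomial.gradedAlgebra

/-- The projective line over `k`, with homogeneous coordinates `X`, `Y`. -/
noncomputable abbrev P1 (k : Type u) [Field k] : Scheme.{u} := Proj (polyGrading k)

/-- The line bundle `𝒪(n)` on the projective line. -/
noncomputable abbrev O (k : Type u) [Field k] (n : ℤ) : (P1 k).Modules := twist (polyGrading k) n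

/-- The direct sum of `r` copies of `𝒪(n)` on the projective line. -/
noncomputable abbrev OSum (k : Type u) [Field k] (n : ℤ) (r : ℕ) : (P1 k).Modules :=
  Limits.biproduct fun _ : Fin r => O k n

open MvPolynomial in
/-- The generators `X³ᵖ, X²ᵖYᵖ, XᵖY²ᵖ, Y³ᵖ, (X⁶ + Y⁶)ᵉ`. -/
noncomputable def gens (k : Type u) [Field k] (p e : ℕ) : Fin 5 → MvPolynomial (Fin 2) k :=
  ![X 0 ^ (3 * p), X 0 ^ (2 * p) * X 1 ^ p, X 0 ^ p * X 1 ^ (2 * p), X 1 ^ (3 * p),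
    (X 0 ^ 6 + X 1 ^ 6) ^ e]

/-- The degrees of the generators. -/
def gensDegree (p e : ℕ) : Fin 5 → ℕ := ![3 * p, 3 * p, 3 * p, 3 * p, 6 * e]

open MvPolynomial in
theorem gens_mem (k : Type u) [Field k] (p e : ℕ) (i : Fin 5) :
    gens k p e i ∈ polyGrading k (gensDegree p e i) := by
  have hX (i : Fin 2) (m : ℕ) : ((X i : MvPolynomial (Fin 2) k) ^ m).IsHomogeneous m := by
    simpa using (isHomogeneous_X k i).pow m
  fin_cases i
  · exact hX 0 _
  · have h := (hX 0 (2 * p)).mul (hX 1 p)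
    rwa [show 2 * p + p = 3 * p by ring] at h
  · have h := (hX 0 p).mul (hX 1 (2 * p))
    rwa [show p + 2 * p = 3 * p by ring] at h
  · exact hX 1 _
  · exact ((hX 0 6).add (hX 1 6)).pow e

/-- `Syz(X³ᵖ, X²ᵖYᵖ, XᵖY²ᵖ, Y³ᵖ, (X⁶ + Y⁶)^((p + 1) / 2))` on the projective line. -/
noncomputable def SPlus (k : Type u) [Field k] (p : ℕ) : (P1 k).Modules :=
  syz (gensDegree p ((p + 1) / 2)) (gens k p ((p + 1) / 2)) (gens_mem k p ((p + 1) / 2))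

/-- `Syz(X³ᵖ, X²ᵖYᵖ, XᵖY²ᵖ, Y³ᵖ, (X⁶ + Y⁶)^((p - 1) / 2))` on the projective line. -/
noncomputable def SMinus (k : Type u) [Field k] (p : ℕ) : (P1 k).Modules :=
  syz (gensDegree p ((p - 1) / 2)) (gens k p ((p - 1) / 2)) (gens_mem k p ((p - 1) / 2))

end ProjTwist

/-! Write `e` for the exponent of `F = X⁶ + Y⁶`. Suppose that four syzygies of degrees `r j + 3p`
with `∑ r j = 6e` are given, and let `A` be the 4×4 matrix of their coefficients at the four
monomial generators. If `det A ≠ 0`, they freely generate the bundle: Cramer's rule shows that `F ^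
e` divides `X ^ (3p) · det A`, hence `det A`, and the degrees agree, so `det A = c F ^ e` with `c ≠
0`. The minor that omits the first generator is then `± c X ^ (3p)`, and at each point one of these
two minors is invertible (`syz_iso_of_independent`, by way of `syz_iso_of_minors`).

The syzygies come from monomials. Multiplying the `i`-th generator (`0 ≤ i ≤ 3`) by `X ^ (r - s) Y ^
s` gives `Y`-exponent `s + ip`. Monomials of the same degree whose `Y`-exponents agree modulo 6 are
a common monomial times powers of `z = Y⁶ / X⁶`, and `F ^ e` becomes `(z + 1) ^ e`. By a Vandermonde
argument, `e` powers of `z` with exponents distinct in `k` form a basis modulo `(z + 1) ^ e`. If `e`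
exponents `s` in `[1, r]` are available, `X ^ r` times the `j`-th generator therefore reduces to the
others modulo `F ^ e` (`exists_syzygy`). At `(1, 0)` only that leading term survives, so `A` becomes
the identity and `det A ≠ 0`.

It remains to count exponents. Every six consecutive integers contain four admissible ones, so `e =
4q + u` leads to `r j = 6q + w j` with small `w j` of sum `6u`; the remainder `u` determines the
splitting type. -/

namespace ProjTwist

universe u

/-! ### Determinants and Cramer's rule for matrices with homogeneous entries. -/

section
variable {A : Type u} {σ : Type*} [CommRing A] [SetLike σ A] [AddSubgroupClass σ A]
variable {𝒜 : ℕ → σ} [GradedRing 𝒜]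

/-- The determinant of a matrix whose `(l, j)` entry is homogeneous of degree `b j - a l`. -/
theorem det_mem_graded {n : ℕ} (N : Matrix (Fin n) (Fin n) A) (a b : Fin n → ℕ)
    (e : Fin n → Fin n → ℕ) (he : ∀ l j, e l j + a l = b j) (hN : ∀ l j, N l j ∈ 𝒜 (e l j)) :
    ∃ D : ℕ, D + ∑ l, a l = ∑ j, b j ∧ N.det ∈ 𝒜 D := by
  -- Every term of the Leibniz expansion has the same degree; the identity permutation exhibits it
  -- without subtraction in `ℕ`.
  have key (τ : Equiv.Perm (Fin n)) : ∑ j, e (τ j) j + ∑ l, a l = ∑ j, b j := by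
    rw [← Equiv.sum_comp τ a, ← Finset.sum_add_distrib]
    exact Finset.sum_congr rfl fun j _ => he _ _
  refine ⟨∑ j, e j j, by simpa using key 1, ?_⟩
  rw [Matrix.det_apply]
  refine sum_mem fun τ _ => ?_
  rw [Units.smul_def]
  refine zsmul_mem ?_ _
  have : ∑ j, e j j = ∑ j, e (τ j) j := by
    have h₁ := key τ
    have h₂ := key 1
    simp only [Equiv.Perm.one_apply] at h₂
    omega
  rw [this]
  exact SetLike.prod_mem_graded _ _ _ fun j _ => hN _ _

/-- The entries of the adjugate of a matrix whose `(l, j)` entry is homogeneous of degree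
`b j - a l`. -/
theorem adjugate_mem_graded {n : ℕ} (N : Matrix (Fin (n + 1)) (Fin (n + 1)) A)
    (a b : Fin (n + 1) → ℕ) (e : Fin (n + 1) → Fin (n + 1) → ℕ)
    (he : ∀ l j, e l j + a l = b j) (hN : ∀ l j, N l j ∈ 𝒜 (e l j)) (j l : Fin (n + 1)) :
    ∃ D : ℕ, D + ∑ l, a l + b j = ∑ j, b j + a l ∧ N.adjugate j l ∈ 𝒜 D := by
  obtain ⟨D, hD, h⟩ := det_mem_graded (𝒜 := 𝒜) (N.submatrix l.succAbove j.succAbove)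
    (a ∘ l.succAbove) (b ∘ j.succAbove) (fun l' j' => e (l.succAbove l') (j.succAbove j'))
    (fun _ _ => he _ _) (fun _ _ => hN _ _)
  refine ⟨D, ?_, ?_⟩
  · rw [Fin.sum_univ_succAbove a l, Fin.sum_univ_succAbove b j]
    simp only [Function.comp_apply] at hD
    omega
  · rw [Matrix.adjugate_fin_succ_eq_det_submatrix]
    obtain h' | h' := neg_one_pow_eq_or A (l + j : ℕ)
    · rw [h', one_mul]; exact h
    · rw [h', neg_one_mul]; exact neg_mem h

/-- The solutions of `M σ = τ`, when `f` is a left kernel vector of `M` that annihilates `τ`. -/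
theorem mulVec_injective_and_exists_of_minor {R : Type*} [CommRing R] {n : ℕ} (f : Fin (n + 1) → R)
    (M : Matrix (Fin (n + 1)) (Fin n) R) (hfM : ∀ j, ∑ i, f i * M i j = 0)
    (i : Fin (n + 1)) (hf : IsUnit (f i)) (hM : IsUnit (M.submatrix i.succAbove id).det) :
    Function.Injective M.mulVec ∧ ∀ τ : Fin (n + 1) → R, ∑ i, f i * τ i = 0 →
      ∃ s : Fin n → R, M.mulVec s = τ ∧ (M.submatrix i.succAbove id).det • s =
        (M.submatrix i.succAbove id).adjugate.mulVec (τ ∘ i.succAbove) := by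
  set N := M.submatrix i.succAbove id with hN
  have hNM (s : Fin n → R) : N.mulVec s = M.mulVec s ∘ i.succAbove := rfl
  constructor
  · intro s t h
    have h' : N.mulVec s = N.mulVec t := by rw [hNM, hNM]; exact congrArg (· ∘ i.succAbove) h
    have h₂ := congrArg N.adjugate.mulVec h'
    simp only [Matrix.mulVec_mulVec, Matrix.adjugate_mul, Matrix.smul_mulVec, Matrix.one_mulVec] at h₂
    exact (hM.smul_left_cancel).1 h₂
  · intro τ hτ
    obtain ⟨u, hu⟩ := hM
    refine ⟨(↑u⁻¹ : R) • N.adjugate.mulVec (τ ∘ i.succAbove), ?_, ?_⟩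
    · set s := (↑u⁻¹ : R) • N.adjugate.mulVec (τ ∘ i.succAbove) with hs
      have h₁ : N.mulVec s = τ ∘ i.succAbove := by
        rw [hs, Matrix.mulVec_smul, Matrix.mulVec_mulVec, Matrix.mul_adjugate,
          Matrix.smul_mulVec, Matrix.one_mulVec, ← hu, smul_smul, Units.inv_mul, one_smul]
      have h₂ (l : Fin n) : M.mulVec s (i.succAbove l) = τ (i.succAbove l) := congrFun h₁ l
      -- Cramer's rule solves all rows but `i`. As `f` annihilates both `M s` and `τ`, and `f i` is
      -- a unit, row `i` follows.
      have h₃ : ∑ i, f i * M.mulVec s i = 0 := by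
        have : ∑ i, f i * M.mulVec s i = ∑ j, (∑ i, f i * M i j) * s j := by
          simp only [Matrix.mulVec, dotProduct, Finset.mul_sum, Finset.sum_mul]
          rw [Finset.sum_comm]
          simp only [mul_assoc]
        rw [this]
        simp [hfM]
      rw [Fin.sum_univ_succAbove _ i] at h₃ hτ
      simp only [h₂] at h₃
      funext l
      obtain rfl | ⟨l, rfl⟩ := i.eq_self_or_eq_succAbove l
      · exact hf.mul_left_cancel (add_right_cancel (h₃.trans hτ.symm))
      · exact h₂ l
    · rw [← hu, smul_smul, Units.mul_inv, one_smul]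

/-! ### Morphisms to `𝒪(n)` through their values at points. -/

variable {n : ℤ} {T : (Proj 𝒜).Modules}

/-- The value at a point `x` of the image of a local section under a morphism to `𝒪(n)`. -/
noncomputable def evalAt (φ : T ⟶ twist 𝒜 n) (U : (Proj 𝒜).Opens)
    (t : T.presheaf.obj (op U)) (x : U) : Loc 𝒜 x.1 :=
  (show sections 𝒜 n (op U) from φ.app U t).1 x

/-- Sections of `𝒪(n)` are by construction functions into the localizations, so identities of
morphisms reduce to linear algebra over local rings. -/
theorem hom_ext_evalAt {φ ψ : T ⟶ twist 𝒜 n}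
    (h : ∀ U t x, evalAt φ U t x = evalAt ψ U t x) : φ = ψ := by
  apply Scheme.Modules.hom_ext
  intro U
  ext t
  exact Subtype.ext (funext fun x => h U t x)

theorem evalAt_add (φ : T ⟶ twist 𝒜 n) (U : (Proj 𝒜).Opens)
    (t t' : T.presheaf.obj (op U)) (x : U) :
    evalAt φ U (t + t') x = evalAt φ U t x + evalAt φ U t' x := by
  unfold evalAt
  rw [map_add]
  rfl

theorem evalAt_smul (φ : T ⟶ twist 𝒜 n) (U : (Proj 𝒜).Opens)
    (r : (ProjectiveSpectrum.Proj.structureSheaf 𝒜).1.obj (op U))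
    (t : T.presheaf.obj (op U)) (x : U) :
    evalAt φ U ((show (Proj 𝒜).presheaf.obj (op U) from r) • t) x =
      (r.1 x).val * evalAt φ U t x := by
  unfold evalAt
  rw [Scheme.Modules.Hom.app_smul]
  rfl

theorem evalAt_map (φ : T ⟶ twist 𝒜 n) {U V : (Proj 𝒜).Opens} (i : V ⟶ U)
    (t : T.presheaf.obj (op U)) (x : V) :
    evalAt φ V (T.presheaf.map i.op t) x = evalAt φ U t (i x) := by
  have := congr($(φ.mapPresheaf.naturality i.op) t)
  exact congrFun (congrArg (fun s : sections 𝒜 n (op V) => s.1) this) x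

theorem evalAt_sum {ι : Type*} (s : Finset ι) (φ : ι → (T ⟶ twist 𝒜 n)) (U : (Proj 𝒜).Opens)
    (t : T.presheaf.obj (op U)) (x : U) :
    evalAt (∑ i ∈ s, φ i) U t x = ∑ i ∈ s, evalAt (φ i) U t x := by
  classical
  induction s using Finset.induction_on with
  | empty => simp; rfl
  | insert a s ha ih =>
    rw [Finset.sum_insert ha, Finset.sum_insert ha, ← ih]
    rfl

theorem evalAt_mem (φ : T ⟶ twist 𝒜 n) (U : (Proj 𝒜).Opens) (t : T.presheaf.obj (op U)) :
    (isLocallyFraction 𝒜 n).pred (fun x : U => evalAt φ U t x) :=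
  (show sections 𝒜 n (op U) from φ.app U t).2

/-- A morphism to `𝒪(n)` from its values at points. -/
noncomputable def homOfEval
    (F : ∀ (U : (Proj 𝒜).Opens) (_ : T.presheaf.obj (op U)) (x : U), Loc 𝒜 x.1)
    (hF : ∀ U t, (isLocallyFraction 𝒜 n).pred (U := U) (F U t))
    (hadd : ∀ U t t' x, F U (t + t') x = F U t x + F U t' x)
    (hsmul : ∀ (U : (Proj 𝒜).Opens) (r : (ProjectiveSpectrum.Proj.structureSheaf 𝒜).1.obj (op U))
      t x, F U ((show (Proj 𝒜).presheaf.obj (op U) from r) • t) x = (r.1 x).val * F U t x)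
    (hres : ∀ (U V : (Proj 𝒜).Opens) (i : V ⟶ U) t (x : V),
      F V (T.presheaf.map i.op t) x = F U t (i x)) : T ⟶ twist 𝒜 n :=
  SheafOfModules.Hom.mk <| PresheafOfModules.homMk
    (M₁ := T.val) (M₂ := (twist 𝒜 n).val)
    { app := fun U => AddCommGrpCat.ofHom
        (show T.presheaf.obj U →+ sections 𝒜 n U from
          AddMonoidHom.mk' (fun t => ⟨F U.unop t, hF U.unop t⟩)
            (fun t t' => Subtype.ext (funext fun x => hadd U.unop t t' x)))
      naturality := fun U V i => by
        ext t
        exact Subtype.ext (funext fun x => hres U.unop V.unop i.unop t x) }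
    (fun U r t => Subtype.ext (funext fun x => hsmul U.unop r t x))

end
end ProjTwist

/-! ### Splitting of a syzygy sheaf from invertible minors. -/

namespace ProjTwist

universe u

section
variable {A : Type u} {σ : Type*} [CommRing A] [SetLike σ A] [AddSubgroupClass σ A]
variable {𝒜 : ℕ → σ} [GradedRing 𝒜]

open Limits

variable {n : ℕ} {d : Fin (n + 2) → ℕ} {f : Fin (n + 2) → A} {m : Fin (n + 1) → ℕ}
  {M : Matrix (Fin (n + 2)) (Fin (n + 1)) A} {E : Fin (n + 2) → Fin (n + 1) → ℕ}

/-- The morphism `⨁ⱼ 𝒪(-mⱼ) ⟶ ⨁ᵢ 𝒪(-dᵢ)` given by a matrix with homogeneous entries. -/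
noncomputable def matrixHom (hE : ∀ i j, E i j + d i = m j) (hM : ∀ i j, M i j ∈ 𝒜 (E i j)) :
    (⨁ fun j => twist 𝒜 (-(m j : ℤ))) ⟶ ⨁ fun i => twist 𝒜 (-(d i : ℤ)) :=
  biproduct.matrix fun j i => mulHom (by have := hE i j; omega) (hM i j)

theorem evalAt_comp_matrixHom (hE : ∀ i j, E i j + d i = m j) (hM : ∀ i j, M i j ∈ 𝒜 (E i j))
    {T : (Proj 𝒜).Modules} (φ : T ⟶ ⨁ fun j => twist 𝒜 (-(m j : ℤ))) (i : Fin (n + 2))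
    (U : (Proj 𝒜).Opens) (t : T.presheaf.obj (op U)) (x : U) :
    evalAt ((φ ≫ matrixHom hE hM) ≫ biproduct.π _ i) U t x =
      ((M.map (algebraMap A (Loc 𝒜 x.1))).mulVec
        fun j => evalAt (φ ≫ biproduct.π _ j) U t x) i := by
  have : (φ ≫ matrixHom hE hM) ≫ biproduct.π _ i =
      ∑ j, (φ ≫ biproduct.π _ j) ≫ mulHom (by have := hE i j; omega) (hM i j) := by
    rw [Category.assoc, matrixHom, biproduct.matrix_π, biproduct.desc_eq, Preadditive.comp_sum]
    simp only [Category.assoc]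
  rw [this, evalAt_sum]
  rfl

theorem evalAt_comp_syzHom {hf : ∀ i, f i ∈ 𝒜 (d i)}
    {T : (Proj 𝒜).Modules} (φ : T ⟶ ⨁ fun i => twist 𝒜 (-(d i : ℤ)))
    (U : (Proj 𝒜).Opens) (t : T.presheaf.obj (op U)) (x : U) :
    evalAt ((φ ≫ syzHom d f hf) ≫ ofUnit) U t x =
      ∑ i, algebraMap A (Loc 𝒜 x.1) (f i) * evalAt (φ ≫ biproduct.π _ i) U t x := by
  have : (φ ≫ syzHom d f hf) ≫ ofUnit =
      ∑ i, (φ ≫ biproduct.π _ i) ≫ (mulHom (by simp) (hf i) : _ ⟶ twist 𝒜 0) := by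
    rw [syzHom, biproduct.desc_eq, Preadditive.comp_sum, Preadditive.sum_comp]
    simp only [Category.assoc, IsIso.inv_hom_id, Category.comp_id]
  rw [this, evalAt_sum]
  rfl

theorem comp_syzHom_eq_zero_iff {hf : ∀ i, f i ∈ 𝒜 (d i)}
    {T : (Proj 𝒜).Modules} (φ : T ⟶ ⨁ fun i => twist 𝒜 (-(d i : ℤ))) :
    φ ≫ syzHom d f hf = 0 ↔ ∀ (U : (Proj 𝒜).Opens) (t : T.presheaf.obj (op U)) (x : U),
      ∑ i, algebraMap A (Loc 𝒜 x.1) (f i) * evalAt (φ ≫ biproduct.π _ i) U t x = 0 := by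
  constructor
  · intro h U t x
    rw [← evalAt_comp_syzHom (hf := hf), h, zero_comp]
    rfl
  · intro h
    rw [← cancel_mono ofUnit, zero_comp]
    refine hom_ext_evalAt fun U t x => ?_
    rw [evalAt_comp_syzHom, h]
    rfl

theorem isUnit_algebraMap_loc {x : ProjectiveSpectrum 𝒜} {a : A} (ha : a ∈ compl 𝒜 x) :
    IsUnit (algebraMap A (Loc 𝒜 x) a) :=
  IsLocalization.map_units (M := compl 𝒜 x) _ ⟨a, ha⟩

/-- Solvability of `M s = τ` over the localization at a point. -/
theorem solve_loc (hfM : ∀ j, ∑ i, f i * M i j = 0) {x : ProjectiveSpectrum 𝒜} {i : Fin (n + 2)}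
    (hfx : f i ∈ compl 𝒜 x) (hMx : (M.submatrix i.succAbove id).det ∈ compl 𝒜 x) :
    Function.Injective (M.map (algebraMap A (Loc 𝒜 x))).mulVec ∧
    ∀ τ : Fin (n + 2) → Loc 𝒜 x, ∑ i, algebraMap A (Loc 𝒜 x) (f i) * τ i = 0 →
      ∃ s : Fin (n + 1) → Loc 𝒜 x, (M.map (algebraMap A (Loc 𝒜 x))).mulVec s = τ ∧
        ∀ j, s j = ∑ l, Localization.mk ((M.submatrix i.succAbove id).adjugate j l)
          ⟨_, hMx⟩ * τ (i.succAbove l) := by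
  set φ := algebraMap A (Loc 𝒜 x) with hφ
  have hdet : ((M.map φ).submatrix i.succAbove id).det = φ (M.submatrix i.succAbove id).det := by
    rw [RingHom.map_det]; rfl
  have hadj (j l) : ((M.map φ).submatrix i.succAbove id).adjugate j l =
      φ ((M.submatrix i.succAbove id).adjugate j l) := by
    have := RingHom.map_adjugate φ (M.submatrix i.succAbove id)
    exact (congrFun (congrFun this j) l).symm
  have hu := isUnit_algebraMap_loc hMx
  obtain ⟨h₁, h₂⟩ := mulVec_injective_and_exists_of_minor (fun i => φ (f i)) (M.map φ)
    (fun j => by simpa using congrArg φ (hfM j)) i (isUnit_algebraMap_loc hfx) (hdet ▸ hu)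
  refine ⟨h₁, fun τ hτ => ?_⟩
  obtain ⟨s, hs, hs'⟩ := h₂ τ hτ
  refine ⟨s, hs, fun j => ?_⟩
  apply hu.mul_left_cancel
  have := congrFun hs' j
  rw [hdet] at this
  refine this.trans ?_
  simp only [Matrix.mulVec, dotProduct, Function.comp_apply, Finset.mul_sum]
  refine Finset.sum_congr rfl fun l _ => ?_
  rw [hadj, ← mul_assoc]
  congr 1
  rw [Localization.mk_eq_mk', mul_comm]
  exact (IsLocalization.mk'_spec (M := compl 𝒜 x) _ _ _).symm

theorem sum_mem_pred {n : ℤ} (U : (Opens (ProjectiveSpectrum.top 𝒜))ᵒᵖ) {ι : Type*} (S : Finset ι)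
    (s : ι → ∀ x : U.unop, Loc 𝒜 x.1) (hs : ∀ i ∈ S, (isLocallyFraction 𝒜 n).pred (s i)) :
    (isLocallyFraction 𝒜 n).pred (fun x => ∑ i ∈ S, s i x) := by
  have := AddSubgroup.sum_mem (sections 𝒜 n U) (f := s) hs
  have h : (∑ i ∈ S, s i : ∀ x : U.unop, Loc 𝒜 x.1) = fun x => ∑ i ∈ S, s i x :=
    funext fun x => Finset.sum_apply x S s
  rw [← h]
  exact this

/-- The local solutions of `M s = τ` depend on `τ` through local fractions. -/
theorem pred_solution (hE : ∀ i j, E i j + d i = m j) (hM : ∀ i j, M i j ∈ 𝒜 (E i j))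
    (hfM : ∀ j, ∑ i, f i * M i j = 0)
    (hloc : ∀ x : ProjectiveSpectrum 𝒜, ∃ i, f i ∈ compl 𝒜 x ∧
      (M.submatrix i.succAbove id).det ∈ compl 𝒜 x)
    (U : Opens (ProjectiveSpectrum.top 𝒜)) (τ : Fin (n + 2) → ∀ x : U, Loc 𝒜 x.1)
    (s : Fin (n + 1) → ∀ x : U, Loc 𝒜 x.1)
    (hτ : ∀ i, (isLocallyFraction 𝒜 (-(d i : ℤ))).pred (τ i))
    (hs : ∀ x : U, (M.map (algebraMap A (Loc 𝒜 x.1))).mulVec (fun j => s j x) = fun i => τ i x)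
    (j : Fin (n + 1)) : (isLocallyFraction 𝒜 (-(m j : ℤ))).pred (s j) := by
  have hτ0 (x : U) : ∑ i, algebraMap A (Loc 𝒜 x.1) (f i) * τ i x = 0 := by
    have h (i) : τ i x = ∑ j, algebraMap A (Loc 𝒜 x.1) (M i j) * s j x :=
      (congrFun (hs x) i).symm
    simp only [h, Finset.mul_sum]
    rw [Finset.sum_comm]
    refine Finset.sum_eq_zero fun j _ => ?_
    have := congrArg (fun a => algebraMap A (Loc 𝒜 x.1) a * s j x) (hfM j)
    simp only [map_sum, map_mul, map_zero, zero_mul, Finset.sum_mul, mul_assoc] at this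
    exact this
  intro x
  obtain ⟨i, hfx, hMx⟩ := hloc x.1
  set N := M.submatrix i.succAbove id with hN
  -- On `V` the same minor and the same `f i` are invertible at every point, so one Cramer formula
  -- describes `s j` on all of `V`.
  let V : Opens (ProjectiveSpectrum.top 𝒜) :=
    U ⊓ (ProjectiveSpectrum.basicOpen 𝒜 N.det ⊓ ProjectiveSpectrum.basicOpen 𝒜 (f i))
  obtain ⟨D, hD, hDm⟩ := det_mem_graded (𝒜 := 𝒜) N (d ∘ i.succAbove) m
    (fun l j => E (i.succAbove l) j) (fun _ _ => hE _ _) (fun _ _ => hM _ _)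
  have hV : (isLocallyFraction 𝒜 (-(m j : ℤ))).pred
      (fun y : V => s j ⟨y.1, y.2.1⟩) := by
    have hform (y : V) : s j ⟨y.1, y.2.1⟩ =
        ∑ l, (Localization.mk (N.adjugate j l) ⟨_, y.2.2.1⟩ : Loc 𝒜 y.1) *
          τ (i.succAbove l) ⟨y.1, y.2.1⟩ := by
      obtain ⟨hinj, hsol⟩ := solve_loc (x := y.1) hfM y.2.2.2 y.2.2.1
      obtain ⟨s', hs', hs''⟩ := hsol (fun i => τ i ⟨y.1, y.2.1⟩) (hτ0 ⟨y.1, y.2.1⟩)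
      have : (fun j => s j ⟨y.1, y.2.1⟩) = s' := hinj ((hs ⟨y.1, y.2.1⟩).trans hs'.symm)
      rw [← hs'' j, ← this]
    rw [funext hform]
    refine sum_mem_pred (op V) _ _ fun l _ => ?_
    obtain ⟨D', hD', hDm'⟩ := adjugate_mem_graded (𝒜 := 𝒜) N (d ∘ i.succAbove) m
      (fun l j => E (i.succAbove l) j) (fun _ _ => hE _ _) (fun _ _ => hM _ _) j l
    -- The adjugate entry over the determinant has degree `d (i.succAbove l) - m j`; multiplication
    -- by `τ` leaves `-m j`.
    refine mul_mem' (m := (D' : ℤ) - D) (n := -(d (i.succAbove l) : ℤ)) ?_ (op V)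
      (fun y : V => (Localization.mk (N.adjugate j l) ⟨_, y.2.2.1⟩ : Loc 𝒜 y.1))
      (fun y : V => τ (i.succAbove l) ⟨y.1, y.2.1⟩) ?_ ?_
    · simp only [Function.comp_apply] at hD hD'
      omega
    · intro y
      exact ⟨V, y.2, 𝟙 _, D', D, _, _, hDm', hDm, by omega, fun z => z.2.2.1, fun z => rfl⟩
    · exact (isLocallyFraction 𝒜 _).res (Opens.infLELeft U _) _ (hτ _)
  obtain ⟨W, hxW, i', hW⟩ := hV ⟨x.1, x.2, hMx, hfx⟩
  exact ⟨W, hxW, i' ≫ Opens.infLELeft U _, hW⟩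

/-- A syzygy sheaf splits if the syzygies have generators given by a matrix, a maximal minor of
which is invertible at each point. -/
theorem syz_iso_of_minors (hE : ∀ i j, E i j + d i = m j) (hM : ∀ i j, M i j ∈ 𝒜 (E i j))
    (hfM : ∀ j, ∑ i, f i * M i j = 0)
    (hf : ∀ i, f i ∈ 𝒜 (d i))
    (hloc : ∀ x : ProjectiveSpectrum 𝒜, ∃ i, f i ∈ compl 𝒜 x ∧
      (M.submatrix i.succAbove id).det ∈ compl 𝒜 x) :
    Nonempty (syz d f hf ≅ ⨁ fun j => twist 𝒜 (-(m j : ℤ))) := by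
  have hinj (x : ProjectiveSpectrum 𝒜) :
      Function.Injective (M.map (algebraMap A (Loc 𝒜 x))).mulVec := by
    obtain ⟨i, h₁, h₂⟩ := hloc x
    exact (solve_loc hfM h₁ h₂).1
  have hzero : matrixHom hE hM ≫ syzHom d f hf = 0 := by
    rw [comp_syzHom_eq_zero_iff]
    intro U t x
    have h (i) := evalAt_comp_matrixHom hE hM (𝟙 _) i U t x
    simp only [Category.id_comp] at h
    simp only [h, Matrix.mulVec, dotProduct, Finset.mul_sum]
    rw [Finset.sum_comm]
    refine Finset.sum_eq_zero fun j _ => ?_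
    have := congrArg (fun a => algebraMap A (Loc 𝒜 x.1) a *
      evalAt (biproduct.π (fun j => twist 𝒜 (-(m j : ℤ))) j) U t x) (hfM j)
    simp only [map_sum, map_mul, map_zero, zero_mul, Finset.sum_mul, mul_assoc] at this
    exact this
  have hmono : Mono (matrixHom hE hM) := by
    rw [Preadditive.mono_iff_cancel_zero]
    intro T g hg
    refine biproduct.hom_ext _ _ fun j => hom_ext_evalAt fun U t x => ?_
    have h : (fun j => evalAt (g ≫ biproduct.π _ j) U t x) = 0 := by
      apply hinj x.1
      rw [Matrix.mulVec_zero]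
      funext i
      rw [← evalAt_comp_matrixHom hE hM g i U t x, hg, zero_comp]
      rfl
    rw [zero_comp]
    exact congrFun h j
  have hlift {T : (Proj 𝒜).Modules} (g : T ⟶ ⨁ fun i => twist 𝒜 (-(d i : ℤ)))
      (hg : g ≫ syzHom d f hf = 0) : ∃ l, l ≫ matrixHom hE hM = g := by
    rw [comp_syzHom_eq_zero_iff] at hg
    have hex (U : (Proj 𝒜).Opens) (t : T.presheaf.obj (op U)) (x : U) :
        ∃ s : Fin (n + 1) → Loc 𝒜 x.1, (M.map (algebraMap A (Loc 𝒜 x.1))).mulVec s =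
          fun i => evalAt (g ≫ biproduct.π _ i) U t x := by
      obtain ⟨i, h₁, h₂⟩ := hloc x.1
      obtain ⟨s, hs, -⟩ := (solve_loc hfM h₁ h₂).2 _ (hg U t x)
      exact ⟨s, hs⟩
    choose s hs using hex
    -- The values `s` are chosen point by point, but injectivity of `M` makes them unique.
    -- Uniqueness yields additivity, linearity and compatibility with restriction.
    let l (j) : T ⟶ twist 𝒜 (-(m j : ℤ)) := homOfEval (fun U t x => s U t x j)
      (fun U t => pred_solution hE hM hfM hloc U
        (fun i x => evalAt (g ≫ biproduct.π _ i) U t x) (fun j x => s U t x j)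
        (fun i => evalAt_mem _ _ _) (fun x => hs U t x) j)
      (fun U t t' x => by
        have : s U (t + t') x = s U t x + s U t' x := by
          apply hinj x.1
          rw [Matrix.mulVec_add, hs, hs, hs]
          exact funext fun i => evalAt_add _ _ _ _ _
        exact congrFun this j)
      (fun U r t x => by
        have : s U ((show (Proj 𝒜).presheaf.obj (op U) from r) • t) x =
            (r.1 x).val • s U t x := by
          apply hinj x.1
          rw [Matrix.mulVec_smul, hs, hs]
          exact funext fun i => evalAt_smul _ _ _ _ _
        exact congrFun this j)
      (fun U V i t x => by
        have : s V (T.presheaf.map i.op t) x = s U t (i x) := by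
          apply hinj x.1
          refine (hs _ _ _).trans (Eq.trans ?_ (hs U t (i x)).symm)
          exact funext fun i' => evalAt_map _ _ _ _
        exact congrFun this j)
    refine ⟨biproduct.lift l, biproduct.hom_ext _ _ fun i => hom_ext_evalAt fun U t x => ?_⟩
    rw [evalAt_comp_matrixHom]
    simp only [biproduct.lift_π]
    exact congrFun (hs U t x) i
  choose l hl using @hlift
  have hlim : IsLimit (KernelFork.ofι (matrixHom hE hM) hzero) :=
    KernelFork.IsLimit.ofι' _ _ fun {T} g hg => ⟨l g hg, hl g hg⟩
  exact ⟨IsLimit.conePointUniqueUpToIso (kernelIsKernel (syzHom d f hf)) hlim⟩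

end
end ProjTwist

/-! ### On the projective line, four independent syzygies of the right total degree suffice. -/

namespace ProjTwist

universe u

section
open MvPolynomial Limits

variable {k : Type u} [Field k]

/-- A point of the projective line does not lie on both `X = 0` and `Y = 0`. -/
theorem exists_X_mem_compl (x : ProjectiveSpectrum (polyGrading k)) :
    ∃ i, (X i : MvPolynomial (Fin 2) k) ∈ compl (polyGrading k) x := by
  -- The shift `-1` forces `j ≥ 1`, so `b` has no constant term and lies in the ideal `(X, Y)`.
  obtain ⟨i, j, b, hb, hij, hbx⟩ := exists_den (𝒜 := polyGrading k) x (-1)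
  by_contra! h
  have h' : Ideal.span (X '' (Set.univ : Set (Fin 2))) ≤ x.asHomogeneousIdeal.toIdeal := by
    rw [Ideal.span_le]
    rintro _ ⟨i, -, rfl⟩
    by_contra hi
    exact h i hi
  refine hbx (h' ?_)
  rw [mem_ideal_span_X_image]
  intro m hm
  have hdeg := (mem_homogeneousSubmodule j b).1 hb (mem_support_iff.1 hm)
  by_contra! h0
  have : m = 0 := Finsupp.ext fun i => h0 i (Set.mem_univ i)
  subst this
  simp only [map_zero] at hdeg
  omega

/-- The form `X⁶ + Y⁶`. -/
noncomputable abbrev sextic (k : Type u) [Field k] : MvPolynomial (Fin 2) k := X 0 ^ 6 + X 1 ^ 6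

theorem not_X_dvd_sextic : ¬ (X 0 : MvPolynomial (Fin 2) k) ∣ sextic k := by
  intro h
  have := map_dvd (eval ![(0 : k), 1]) h
  simp at this

theorem sextic_ne_zero : sextic k ≠ 0 := fun h => not_X_dvd_sextic (k := k) (h ▸ dvd_zero _)

theorem isHomogeneous_sextic_pow (e : ℕ) : (sextic k ^ e).IsHomogeneous (6 * e) := by
  have hX (i : Fin 2) : ((X i : MvPolynomial (Fin 2) k) ^ 6).IsHomogeneous 6 := by
    simpa using (isHomogeneous_X k i).pow 6
  exact ((hX 0).add (hX 1)).pow e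

theorem sextic_pow_dvd_of_dvd_X_pow_mul {e n : ℕ} {a : MvPolynomial (Fin 2) k}
    (h : sextic k ^ e ∣ X 0 ^ n * a) : sextic k ^ e ∣ a := by
  have hirr : Irreducible (X 0 : MvPolynomial (Fin 2) k) := (X_prime (i := 0)).irreducible
  have : IsRelPrime (sextic k ^ e) (X 0 ^ n) :=
    ((hirr.isRelPrime_iff_not_dvd.2 not_X_dvd_sextic).symm.pow_left).pow_right
  exact this.dvd_of_dvd_mul_left h

theorem eq_C_mul_of_dvd {a b : MvPolynomial (Fin 2) k} {n : ℕ} (ha : a.IsHomogeneous n)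
    (hb : b.IsHomogeneous n) (hb0 : b ≠ 0) (ha0 : a ≠ 0) (h : a ∣ b) :
    ∃ c : k, c ≠ 0 ∧ b = C c * a := by
  obtain ⟨q, rfl⟩ := h
  have hq0 : q ≠ 0 := right_ne_zero_of_mul hb0
  have h₁ := totalDegree_mul_of_isDomain ha0 hq0
  rw [hb.totalDegree hb0, ha.totalDegree ha0] at h₁
  have hq := totalDegree_eq_zero_iff_eq_C.1 (show q.totalDegree = 0 by omega)
  refine ⟨coeff 0 q, fun h => hq0 (by rw [hq, h, map_zero]), ?_⟩
  rw [← hq, mul_comm]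

variable {p e : ℕ} {A : Matrix (Fin 4) (Fin 4) (MvPolynomial (Fin 2) k)}
  {b : Fin 4 → MvPolynomial (Fin 2) k} {r : Fin 4 → ℕ}

/-- Modulo `sextic k ^ e` the monomial generators form a left kernel vector of `A`. Multiplying by
the adjugate gives `sextic k ^ e ∣ X 0 ^ (3 * p) * A.det`; the sextic is prime to `X 0`, and both
sides of the conclusion have degree `6 * e`. -/
theorem det_eq_C_mul_sextic_pow
    (hA : ∀ i j, (A i j).IsHomogeneous (r j))
    (hr : ∑ j, r j = 6 * e) (hdet : A.det ≠ 0)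
    (hrel : ∀ j, ∑ i : Fin 4, gens k p e i.castSucc * A i j + sextic k ^ e * b j = 0) :
    ∃ c : k, c ≠ 0 ∧ A.det = C c * sextic k ^ e := by
  obtain ⟨D, hD, hdeg⟩ := det_mem_graded (𝒜 := polyGrading k) A 0 r (fun _ j => r j)
    (fun _ _ => rfl) hA
  have hD' : D = 6 * e := by simpa [hr] using hD
  subst hD'
  refine eq_C_mul_of_dvd (isHomogeneous_sextic_pow e) hdeg hdet
    (pow_ne_zero _ sextic_ne_zero) ?_
  refine sextic_pow_dvd_of_dvd_X_pow_mul (n := 3 * p) ?_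
  have h₁ : Matrix.vecMul (fun i : Fin 4 => gens k p e i.castSucc) A = -(sextic k ^ e • b) := by
    funext j
    exact eq_neg_of_add_eq_zero_left (hrel j)
  have h₂ := congrArg (fun v => Matrix.vecMul v A.adjugate) h₁
  simp only [Matrix.vecMul_vecMul, Matrix.mul_adjugate, Matrix.vecMul_smul, Matrix.vecMul_one,
    Matrix.neg_vecMul, Matrix.smul_vecMul] at h₂
  have h₃ := congrFun h₂ 0
  simp only [Pi.smul_apply, Pi.neg_apply, smul_eq_mul] at h₃
  have h₄ : gens k p e (Fin.castSucc 0) = X 0 ^ (3 * p) := rfl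
  rw [h₄] at h₃
  rw [mul_comm, h₃, ← mul_neg]
  exact dvd_mul_right _ _

/-- The matrix `A` with `b` as an additional last row. -/
def addRow (A : Matrix (Fin 4) (Fin 4) (MvPolynomial (Fin 2) k))
    (b : Fin 4 → MvPolynomial (Fin 2) k) : Matrix (Fin 5) (Fin 4) (MvPolynomial (Fin 2) k) :=
  Matrix.of (Fin.snoc (α := fun _ => Fin 4 → MvPolynomial (Fin 2) k) A b)

theorem addRow_castSucc (i : Fin 4) : addRow A b i.castSucc = A i :=
  Fin.snoc_castSucc (α := fun _ => Fin 4 → MvPolynomial (Fin 2) k) _ _ _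

theorem addRow_last : addRow A b (Fin.last 4) = b :=
  Fin.snoc_last (α := fun _ : Fin 5 => Fin 4 → MvPolynomial (Fin 2) k) b A

theorem addRow_submatrix_zero :
    (addRow A b).submatrix (Fin.succAbove 0) id = Matrix.of ![A 1, A 2, A 3, b] := by
  ext1 i j
  rw [Matrix.submatrix_apply, Fin.succAbove_zero, id]
  fin_cases i
  · exact congrFun (addRow_castSucc (A := A) (b := b) 1) j
  · exact congrFun (addRow_castSucc (A := A) (b := b) 2) j
  · exact congrFun (addRow_castSucc (A := A) (b := b) 3) j
  · exact congrFun (addRow_last (A := A) (b := b)) j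

theorem submatrix_finRotate (A : Matrix (Fin 4) (Fin 4) (MvPolynomial (Fin 2) k)) :
    A.submatrix (finRotate 4) id = Matrix.of ![A 1, A 2, A 3, A 0] := by
  ext1 i j
  fin_cases i <;> rfl

/-- Scaling the row `b` by `sextic k ^ e` and adding multiples of the other rows turns it, by the
relation, into `-X 0 ^ (3 * p)` times row 0 of `A`. The sign comes from this and from the cyclic
rotation of the rows. -/
theorem sextic_pow_mul_det_minor
    (hrel : ∀ j, ∑ i : Fin 4, gens k p e i.castSucc * A i j + sextic k ^ e * b j = 0) :
    ∃ ε : ℤˣ, sextic k ^ e * ((addRow A b).submatrix (Fin.succAbove 0) id).det =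
      (ε : ℤ) • (X 0 ^ (3 * p) * A.det) := by
  rw [addRow_submatrix_zero]
  set N : Matrix (Fin 4) (Fin 4) (MvPolynomial (Fin 2) k) :=
    Matrix.of ![A 1, A 2, A 3, b] with hN
  have h₁ := Matrix.det_updateRow_sum N 3 (fun i => gens k p e i.succ)
  have h₂ : N.updateRow 3 (∑ i : Fin 4, gens k p e i.succ • N i) =
      (A.submatrix (finRotate 4) id).updateRow 3
        (-((X 0 : MvPolynomial (Fin 2) k) ^ (3 * p)) • A 0) := by
    have hsum : ∑ i : Fin 4, gens k p e i.succ • N i =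
        -((X 0 : MvPolynomial (Fin 2) k) ^ (3 * p)) • A 0 := by
      funext j
      have h : X 0 ^ (3 * p) * A 0 j + X 0 ^ (2 * p) * X 1 ^ p * A 1 j +
          X 0 ^ p * X 1 ^ (2 * p) * A 2 j + X 1 ^ (3 * p) * A 3 j + sextic k ^ e * b j = 0 := by
        rw [← hrel j, Fin.sum_univ_four]
        rfl
      have h' : (∑ i : Fin 4, gens k p e i.succ • N i) j =
          X 0 ^ (2 * p) * X 1 ^ p * A 1 j +
          X 0 ^ p * X 1 ^ (2 * p) * A 2 j + X 1 ^ (3 * p) * A 3 j + sextic k ^ e * b j := by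
        rw [Fin.sum_univ_four]
        rfl
      rw [h', Pi.smul_apply, smul_eq_mul]
      linear_combination h
    rw [hsum, submatrix_finRotate]
    ext1 i j
    fin_cases i <;> rfl
  rw [h₂, Matrix.det_updateRow_smul] at h₁
  have h₃ : (A.submatrix (finRotate 4) id).updateRow 3 (A 0) = A.submatrix (finRotate 4) id := by
    rw [submatrix_finRotate]
    ext1 i j
    fin_cases i <;> rfl
  rw [h₃, Matrix.det_permute] at h₁
  refine ⟨-(finRotate 4).sign, ?_⟩
  have g0 : gens k p e (Fin.succ 3) = sextic k ^ e := rfl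
  rw [g0, smul_eq_mul] at h₁
  rw [← h₁, zsmul_eq_mul]
  push_cast
  ring

/-- The syzygy bundle splits if there are four syzygies, of total degree `12 p + 6 e`, that are
linearly independent. -/
theorem syz_iso_of_independent {s : Fin 4 → ℕ}
    (hA : ∀ i j, (A i j).IsHomogeneous (r j)) (hb : ∀ j, (b j).IsHomogeneous (s j))
    (hs : ∀ j, s j + 6 * e = r j + 3 * p)
    (hr : ∑ j, r j = 6 * e) (hdet : A.det ≠ 0)
    (hrel : ∀ j, ∑ i : Fin 4, gens k p e i.castSucc * A i j + sextic k ^ e * b j = 0) :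
    Nonempty (syz (gensDegree p e) (gens k p e) (gens_mem k p e) ≅
      ⨁ fun j => O k (-((r j + 3 * p : ℕ) : ℤ))) := by
  obtain ⟨c, hc, hdetA⟩ := det_eq_C_mul_sextic_pow hA hr hdet hrel
  obtain ⟨ε, hε⟩ := sextic_pow_mul_det_minor hrel
  have hCc : IsUnit (C c : MvPolynomial (Fin 2) k) := (IsUnit.mk0 c hc).map C
  have hunit (u : MvPolynomial (Fin 2) k) (hu : IsUnit u)
      (x : ProjectiveSpectrum (polyGrading k)) : u ∈ compl (polyGrading k) x := fun h =>
    x.isPrime.ne_top (Ideal.eq_top_of_isUnit_mem _ h hu)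
  refine syz_iso_of_minors (n := 3) (M := addRow A b)
    (E := fun i j => (Fin.snoc (α := fun _ => ℕ) (fun _ : Fin 4 => r j) (s j) : Fin 5 → ℕ) i)
    ?_ ?_ ?_ (gens_mem k p e) ?_
  · intro i j
    refine Fin.lastCases ?_ (fun i => ?_) i
    · rw [Fin.snoc_last]; exact hs j
    · rw [Fin.snoc_castSucc]
      fin_cases i <;> rfl
  · intro i j
    refine Fin.lastCases ?_ (fun i => ?_) i
    · rw [Fin.snoc_last, addRow_last]; exact hb j
    · rw [Fin.snoc_castSucc, addRow_castSucc]; exact hA i j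
  · intro j
    rw [Fin.sum_univ_castSucc]
    simp only [addRow_castSucc]
    rw [addRow_last]
    exact hrel j
  · intro x
    -- Where the sextic does not vanish, omit the last generator: the minor is `A.det`. Elsewhere `X
    -- 0` cannot vanish, for otherwise `X 1` would too, and the first generator is omitted.
    by_cases hx : sextic k ∈ compl (polyGrading k) x
    · have hx' := (compl (polyGrading k) x).pow_mem hx e
      refine ⟨Fin.last 4, hx', ?_⟩
      have : (addRow A b).submatrix (Fin.last 4).succAbove id = A := by
        ext i j
        rw [Fin.succAbove_last]
        exact congrArg _ (congrFun (addRow_castSucc i) j)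
      rw [this, hdetA]
      exact mul_mem (hunit _ hCc x) hx'
    · have hX : X 0 ∈ compl (polyGrading k) x := by
        by_contra h0
        obtain ⟨i, hi⟩ := exists_X_mem_compl x
        fin_cases i
        · exact h0 hi
        · have h0' : X 0 ∈ x.asHomogeneousIdeal.toIdeal := not_not.1 h0
          have hx' : sextic k ∈ x.asHomogeneousIdeal.toIdeal := not_not.1 hx
          have : (X 1 : MvPolynomial (Fin 2) k) ^ 6 ∈ x.asHomogeneousIdeal.toIdeal :=
            (Ideal.add_mem_iff_right _ (Ideal.pow_mem_of_mem _ h0' 6 (by norm_num))).1 hx'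
          exact hi (x.isPrime.mem_of_pow_mem _ this)
      refine ⟨0, (compl (polyGrading k) x).pow_mem hX _, ?_⟩
      have h₁ : ((addRow A b).submatrix (Fin.succAbove 0) id).det =
          ((ε : ℤ) : MvPolynomial (Fin 2) k) * (C c * X 0 ^ (3 * p)) := by
        apply mul_left_cancel₀ (pow_ne_zero e (sextic_ne_zero (k := k)))
        rw [hε, hdetA, zsmul_eq_mul]
        ring
      refine h₁ ▸ mul_mem (hunit _ ?_ x) (mul_mem (hunit _ hCc x)
        ((compl (polyGrading k) x).pow_mem hX _))
      exact (Units.isUnit ε).map (Int.castRingHom (MvPolynomial (Fin 2) k))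

end
end ProjTwist

/-! ### Powers of one variable modulo `(X + 1) ^ e`, and the syzygies they produce. -/

namespace ProjTwist

universe u

section
variable {k : Type u} [Field k]

open Polynomial in
/-- A combination of `e` powers of `X`, with exponents that are distinct in `k`, vanishes if it
vanishes to order `e` at `-1`. -/
theorem eq_zero_of_X_add_one_pow_dvd {e : ℕ} (t : Fin e → ℕ)
    (ht : Function.Injective fun i => (t i : k)) (c : Fin e → k)
    (h : (X + 1 : k[X]) ^ e ∣ ∑ i, C (c i) * X ^ t i) : c = 0 := by
  -- The Euler operator `X · d/dX` multiplies `X ^ t` by `t` and lowers the order of vanishing at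
  -- `-1` by at most one.
  have key (j : ℕ) : (X + 1 : k[X]) ^ (e - j) ∣ ∑ i, C (c i * (t i : k) ^ j) * X ^ t i := by
    induction j with
    | zero => simpa using h
    | succ j ih =>
      have h₁ := (pow_sub_one_dvd_derivative_of_pow_dvd ih).mul_left X
      rw [← Nat.sub_sub]
      convert h₁ using 1
      rw [derivative_sum, Finset.mul_sum]
      refine Finset.sum_congr rfl fun i _ => ?_
      rw [derivative_C_mul, derivative_X_pow]
      obtain h0 | h0 := Nat.eq_zero_or_pos (t i)
      · simp [h0]
      · have hX : (X : k[X]) ^ t i = X * X ^ (t i - 1) := by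
          rw [← pow_succ', Nat.sub_add_cancel h0]
        rw [hX, pow_succ]
        simp only [C_mul, C_pow]
        ring
  -- Evaluation at `-1` for all `j < e` gives a Vandermonde system with the distinct nodes `t i`.
  have hv : (fun i => c i * (-1) ^ t i) = 0 := by
    refine Matrix.eq_zero_of_forall_pow_sum_mul_pow_eq_zero ht fun j => ?_
    have h₁ : (X + 1 : k[X]) ∣ ∑ i, C (c i * (t i : k) ^ (j : ℕ)) * X ^ t i :=
      (dvd_pow_self _ (by omega)).trans (key j)
    have h₂ := eval_dvd (x := -1) h₁
    simp only [eval_add, eval_X, eval_one, neg_add_cancel, zero_dvd_iff, eval_finsetSum,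
      eval_mul, eval_C, eval_pow] at h₂
    rw [← h₂]
    exact Finset.sum_congr rfl fun i _ => by ring
  funext i
  have := congrFun hv i
  simpa using this

open Polynomial in
/-- The powers of `X` with `e` exponents that are distinct in `k` span `k[X] / (X + 1) ^ e`. -/
theorem exists_X_add_one_pow_dvd_sub {e : ℕ} (t : Fin e → ℕ)
    (ht : Function.Injective fun i => (t i : k)) (f : k[X]) :
    ∃ c : Fin e → k, (X + 1 : k[X]) ^ e ∣ f - ∑ i, C (c i) * X ^ t i := by
  have hmon : ((X + 1 : k[X]) ^ e).Monic := (monic_X_add_C (1 : k)).pow e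
  have hdeg (g : k[X]) : g %ₘ (X + 1) ^ e ∈ degreeLT k e := by
    rw [mem_degreeLT]
    refine (degree_modByMonic_lt g hmon).trans_le ?_
    have : ((X + 1 : k[X]) ^ e).degree = e := by
      simpa using congrArg ((e : WithBot ℕ) * ·) (degree_X_add_C (1 : k))
    exact this.le
  -- `ψ` takes the coefficients of the remainder modulo `(X + 1) ^ e`. There are as many powers as
  -- coefficients, so independence implies spanning.
  let ψ : k[X] →ₗ[k] Fin e → k :=
    (degreeLTEquiv k e).toLinearMap ∘ₗ (modByMonicHom ((X + 1 : k[X]) ^ e)).codRestrict _ hdeg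
  have hψ (g : k[X]) : ψ g = 0 ↔ (X + 1 : k[X]) ^ e ∣ g := by
    rw [← modByMonic_eq_zero_iff_dvd hmon]
    change degreeLTEquiv k e ⟨g %ₘ (X + 1) ^ e, hdeg g⟩ = 0 ↔ _
    rw [LinearEquiv.map_eq_zero_iff, Submodule.mk_eq_zero]
  let χ : (Fin e → k) →ₗ[k] k[X] := Fintype.linearCombination k fun i => (X : k[X]) ^ t i
  have hχ (c : Fin e → k) : χ c = ∑ i, C (c i) * X ^ t i := by
    simp only [χ, Fintype.linearCombination_apply, smul_eq_C_mul]
  have hinj : Function.Injective (ψ ∘ₗ χ) := by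
    rw [← LinearMap.ker_eq_bot, LinearMap.ker_eq_bot']
    intro c hc
    exact eq_zero_of_X_add_one_pow_dvd t ht c (hχ c ▸ (hψ _).1 hc)
  obtain ⟨c, hc⟩ := LinearMap.injective_iff_surjective.1 hinj (ψ f)
  refine ⟨c, hχ c ▸ (hψ _).1 ?_⟩
  rw [map_sub, ← hc]
  exact sub_self _

theorem homogenize_X_add_one_pow (e : ℕ) :
    ((Polynomial.X + 1 : Polynomial k) ^ e).homogenize e =
      (MvPolynomial.X 0 + MvPolynomial.X 1) ^ e := by
  induction e with
  | zero => simp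
  | succ e ih =>
    have h1 : (Polynomial.X + 1 : Polynomial k).natDegree ≤ 1 := by
      simpa using (Polynomial.natDegree_X_add_C (1 : k)).le
    have he : ((Polynomial.X + 1 : Polynomial k) ^ e).natDegree ≤ e := by
      simpa using Polynomial.natDegree_pow_le_of_le e h1
    rw [pow_succ, Polynomial.homogenize_mul _ _ he h1, ih, pow_succ, Polynomial.homogenize_add]
    simp

open MvPolynomial

/-- The homogenization of `P(Y⁶ / X⁶)`. -/
theorem exists_sextic_pow_mul_eq {e n : ℕ} {P : Polynomial k} (hP : P.natDegree ≤ n)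
    (h : (Polynomial.X + 1) ^ e ∣ P) : ∃ B : MvPolynomial (Fin 2) k,
      (B = 0 ∨ e ≤ n ∧ B.IsHomogeneous (6 * (n - e))) ∧
      aeval ![(X 1 : MvPolynomial (Fin 2) k) ^ 6, X 0 ^ 6] (P.homogenize n) = sextic k ^ e * B := by
  obtain ⟨Q, rfl⟩ := h
  -- The zero polynomial is set apart because `P = 0` does not force `e ≤ n`.
  obtain rfl | hQ := eq_or_ne Q 0
  · exact ⟨0, Or.inl rfl, by simp⟩
  have hmon : ((Polynomial.X + 1 : Polynomial k) ^ e).Monic := (Polynomial.monic_X_add_C (1 : k)).pow e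
  have hdeg : ((Polynomial.X + 1 : Polynomial k) ^ e).natDegree = e := by
    have := Polynomial.natDegree_pow (Polynomial.X + Polynomial.C (1 : k)) e
    rwa [Polynomial.natDegree_X_add_C, mul_one] at this
  rw [hmon.natDegree_mul' hQ, hdeg] at hP
  obtain ⟨l, rfl⟩ := Nat.exists_eq_add_of_le (show e ≤ n by omega)
  refine ⟨aeval ![(X 1 : MvPolynomial (Fin 2) k) ^ 6, X 0 ^ 6] (Q.homogenize l), Or.inr ⟨by omega, ?_⟩, ?_⟩
  · rw [Nat.add_sub_cancel_left]
    refine (Polynomial.isHomogeneous_homogenize Q).aeval _ fun i => ?_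
    fin_cases i
    · simpa using (isHomogeneous_X k 1).pow 6
    · simpa using (isHomogeneous_X k 0).pow 6
  · rw [Polynomial.homogenize_mul _ _ hdeg.le (by omega), homogenize_X_add_one_pow, map_mul,
      map_pow, map_add, aeval_X, aeval_X, add_comm]
    rfl

theorem gens_castSucc (p e : ℕ) (i : Fin 4) :
    gens k p e i.castSucc = X 0 ^ ((3 - i) * p) * X 1 ^ (i * p) := by
  fin_cases i <;> simp [gens]

variable {p : ℕ} [CharP k p]

/-- A syzygy with a prescribed shape, in terms of the exponents of `Y` that occur in it. -/
theorem exists_syzygy {e r l : ℕ} (j : Fin 4) (s : Fin e → ℕ) (hs : Function.Injective s)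
    (hs0 : ∀ x, 0 < s x) (hsr : ∀ x, s x ≤ r) (hrp : r ≤ p) (i : Fin e → Fin 4)
    (hi : ∀ x, s x + i x * p ≡ j * p [MOD 6]) (hl : l + 6 * e = r + 3 * p) :
    ∃ (A : Fin 4 → MvPolynomial (Fin 2) k) (B : MvPolynomial (Fin 2) k),
      (∀ y, (A y).IsHomogeneous r) ∧ B.IsHomogeneous l ∧
      (∀ y, eval ![1, 0] (A y) = if y = j then 1 else 0) ∧
      ∑ y : Fin 4, gens k p e y.castSucc * A y + sextic k ^ e * B = 0 := by
  -- All `Y`-exponents in play are `a + 6 t`, so every monomial is `X ^ b Y ^ a` times a monomial of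
  -- degree `n` in `X⁶` and `Y⁶`.
  set a := (j * p : ℕ) % 6 with ha
  obtain ⟨t₀, ht₀⟩ : ∃ t₀, (j * p : ℕ) = a + 6 * t₀ :=
    ⟨(j * p : ℕ) / 6, (Nat.mod_add_div _ _).symm⟩
  have hE (x) : ∃ t, s x + i x * p = a + 6 * t := by
    refine ⟨(s x + i x * p) / 6, ?_⟩
    rw [ha, ← hi x]
    exact (Nat.mod_add_div _ _).symm
  choose t ht using hE
  have hip (y : Fin 4) : (y * p : ℕ) ≤ 3 * p := Nat.mul_le_mul_right _ (by omega)
  have hip' (y : Fin 4) : (3 - y) * p + y * p = 3 * p := by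
    rw [← add_mul, Nat.sub_add_cancel (by omega)]
  obtain ⟨n, b, hnb⟩ : ∃ n b, r + 3 * p = a + b + 6 * n ∧ b < 6 := by
    have := hip j
    exact ⟨(r + 3 * p - a) / 6, (r + 3 * p - a) % 6, by omega, by omega⟩
  have htn₀ : t₀ ≤ n := by have := hip j; omega
  have htn (x) : t x ≤ n := by have := hip (i x); have := ht x; have := hsr x; omega
  -- In `k` one has `s x = a + 6 t x`, so equal `t` give congruent `s` modulo `p`. The `s x` lie in
  -- `[1, p]`, where residues are distinct; excluding `0` is what permits the value `p`.
  have htinj : Function.Injective fun x => (t x : k) := by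
    intro x y hxy
    have h (x) : (s x : k) = a + 6 * t x := by
      have := congrArg (Nat.cast : ℕ → k) (ht x)
      push_cast at this
      rw [← this, CharP.cast_eq_zero k p, mul_zero, add_zero]
    have h' : (s x : k) = s y := by rw [h, h]; simp only at hxy; rw [hxy]
    rw [CharP.natCast_eq_natCast k p] at h'
    apply hs
    have hx := hsr x
    have hy := hsr y
    have hx0 := hs0 x
    have hy0 := hs0 y
    obtain hx' | hx' := (hx.trans hrp).lt_or_eq <;> obtain hy' | hy' := (hy.trans hrp).lt_or_eq
    · exact h'.eq_of_lt_of_lt hx' hy'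
    · rw [hy', Nat.modEq_iff_dvd' hx'.le] at h'
      have := Nat.le_of_dvd (by omega) h'
      omega
    · rw [hx'] at h'
      have h' := h'.symm
      rw [Nat.modEq_iff_dvd' hy'.le] at h'
      have := Nat.le_of_dvd (by omega) h'
      omega
    · omega
  obtain ⟨c, hc⟩ := exists_X_add_one_pow_dvd_sub (k := k) t htinj (Polynomial.X ^ t₀)
  have hdeg : (Polynomial.X ^ t₀ - ∑ x, Polynomial.C (c x) * Polynomial.X ^ t x :
      Polynomial k).natDegree ≤ n := by
    refine (Polynomial.natDegree_sub_le _ _).trans (max_le ?_ ?_)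
    · simpa using htn₀
    · exact Polynomial.natDegree_sum_le_of_forall_le _ _ fun x _ =>
        (Polynomial.natDegree_C_mul_X_pow_le _ _).trans (htn x)
  obtain ⟨B, hB, hPB⟩ := exists_sextic_pow_mul_eq hdeg hc
  have hX (i : Fin 2) (m : ℕ) : ((X i : MvPolynomial (Fin 2) k) ^ m).IsHomogeneous m := by
    simpa using (isHomogeneous_X k i).pow m
  have hXX {u v w : ℕ} (h : u + v = w) :
      ((X 0 : MvPolynomial (Fin 2) k) ^ u * X 1 ^ v).IsHomogeneous w :=
    h ▸ (hX 0 u).mul (hX 1 v)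
  -- All terms other than `X 0 ^ r` contain a positive power of `X 1` and vanish at `(1, 0)`.
  refine ⟨fun y => (if y = j then X 0 ^ r else 0) -
      ∑ x, if i x = y then C (c x) * (X 0 ^ (r - s x) * X 1 ^ s x) else 0,
    -(X 0 ^ b * X 1 ^ a * B), ?_, ?_, ?_, ?_⟩
  · intro y
    refine IsHomogeneous.sub ?_ (IsHomogeneous.sum _ _ _ fun x _ => ?_)
    · split_ifs
      · exact hX 0 r
      · exact isHomogeneous_zero _ _ _
    · split_ifs
      · exact (hXX (Nat.sub_add_cancel (hsr x))).C_mul _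
      · exact isHomogeneous_zero _ _ _
  · obtain rfl | ⟨hen, hB⟩ := hB
    · simpa using isHomogeneous_zero _ _ l
    · have hl' : l = a + b + 6 * (n - e) := by omega
      rw [hl']
      exact ((hXX (add_comm b a)).mul hB).neg
  · intro y
    have h0 (x) : (0 : k) ^ s x = 0 := zero_pow (hs0 x).ne'
    simp [apply_ite, h0]
  · have hmono {E t : ℕ} (h : E = a + 6 * t) (ht : t ≤ n) :
        (X 0 : MvPolynomial (Fin 2) k) ^ (r + 3 * p - E) * X 1 ^ E =
          X 0 ^ b * X 1 ^ a * aeval ![(X 1 : MvPolynomial (Fin 2) k) ^ 6, X 0 ^ 6]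
            ((Polynomial.X ^ t : Polynomial k).homogenize n) := by
      rw [Polynomial.homogenize_X_pow ht]
      have : r + 3 * p - E = b + 6 * (n - t) := by omega
      rw [this, h]
      simp only [map_mul, map_pow, aeval_X, Matrix.cons_val_zero, Matrix.cons_val_one]
      ring
    have h₁ : ∑ y : Fin 4, gens k p e y.castSucc * (if y = j then X 0 ^ r else 0) =
        X 0 ^ (r + 3 * p - j * p) * X 1 ^ (j * p : ℕ) := by
      simp only [mul_ite, mul_zero, Finset.sum_ite_eq', Finset.mem_univ, if_true, gens_castSucc]
      rw [← hip' j, ← add_assoc, Nat.add_sub_cancel, pow_add]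
      ring
    have h₂ : ∑ y : Fin 4, gens k p e y.castSucc *
        (∑ x, if i x = y then C (c x) * (X 0 ^ (r - s x) * X 1 ^ s x) else 0) =
        ∑ x, C (c x) * (X 0 ^ (r + 3 * p - (s x + i x * p)) * X 1 ^ (s x + i x * p)) := by
      simp only [Finset.mul_sum]
      rw [Finset.sum_comm]
      refine Finset.sum_congr rfl fun x _ => ?_
      simp only [mul_ite, mul_zero, Finset.sum_ite_eq, Finset.mem_univ, if_true, gens_castSucc]
      have : r + 3 * p - (s x + i x * p) = (r - s x) + (3 - i x) * p := by
        have := hip' (i x)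
        have := hsr x
        omega
      rw [this, pow_add, pow_add]
      ring
    simp only [mul_sub, Finset.sum_sub_distrib]
    rw [h₁, h₂, hmono ht₀ htn₀, Finset.sum_congr rfl fun x _ => by rw [hmono (ht x) (htn x)]]
    rw [mul_neg, mul_left_comm, ← hPB, Polynomial.homogenize_sub, Polynomial.homogenize_finsetSum,
      map_sub, map_sum]
    simp only [Polynomial.homogenize_C_mul, map_mul, algHom_C, algebraMap_eq, mul_sub,
      Finset.mul_sum, mul_left_comm (C _)]
    ring

end
end ProjTwist

/-! ### Counting the admissible exponents. -/

namespace ProjTwist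

universe u

/-- The residue classes modulo `6` of the exponents in the `j`-th syzygy, when `p ≡ ε` modulo `6`. -/
abbrev IsExponent (ε : ℕ) (j : Fin 4) (s : ℕ) : Prop :=
  ∃ i : Fin 4, (s + i * ε) % 6 = (j * ε) % 6

/-- As `ε` is a unit modulo 6, the four values of `i` give four distinct residues of `s`, hence four
exponents in each period. -/
theorem count_isExponent_add {ε : ℕ} (hε : ε = 1 ∨ ε = 5) (j : Fin 4) (q v : ℕ) :
    Nat.count (IsExponent ε j) (6 * q + v) = 4 * q + Nat.count (IsExponent ε j) v := by
  induction q with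
  | zero => simp
  | succ q ih =>
    rw [show 6 * (q + 1) + v = 6 + (6 * q + v) by ring, Nat.count_add]
    have h (s : ℕ) : IsExponent ε j (6 + s) ↔ IsExponent ε j s := by
      simp only [IsExponent, add_assoc, Nat.add_mod_left]
    simp only [h]
    rw [ih]
    have : Nat.count (IsExponent ε j) 6 = 4 := by
      clear ih h
      obtain rfl | rfl := hε <;> revert j <;> decide
    rw [this]
    ring

/-- Enumeration of the positive exponents. -/
theorem exists_enum_isExponent {ε : ℕ} (j : Fin 4) {r e : ℕ}
    (hcount : Nat.count (IsExponent ε j) (r + 1) = e + 1) :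
    ∃ s : Fin e → ℕ, Function.Injective s ∧ ∀ x, 0 < s x ∧ s x ≤ r ∧ IsExponent ε j (s x) := by
  -- The exponent `0` is always admissible (take `i = j`) and belongs to the monomial to be reduced;
  -- removing it leaves `e`.
  set S := ((Finset.range (r + 1)).filter (IsExponent ε j)).erase 0 with hS
  have hcard : S.card = e := by
    rw [hS, Finset.card_erase_of_mem, ← Nat.count_eq_card_filter_range, hcount,
      Nat.add_sub_cancel]
    rw [Finset.mem_filter, Finset.mem_range]
    exact ⟨by omega, j, by rw [zero_add]⟩
  refine ⟨S.orderEmbOfFin hcard, (S.orderEmbOfFin hcard).injective, fun x => ?_⟩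
  have := S.orderEmbOfFin_mem hcard x
  generalize S.orderEmbOfFin hcard x = y at this
  rw [hS, Finset.mem_erase, Finset.mem_filter, Finset.mem_range] at this
  exact ⟨by omega, by omega, this.2.2⟩

section
open Limits MvPolynomial

variable {k : Type u} [Field k] {p : ℕ} [CharP k p]

/-- The `q` full periods contribute `4 * q` exponents and the interval `[0, w j]` contributes `u +
1`: one for the leading monomial and `e` for the basis in which it is expressed. -/
theorem syz_iso_of_count {ε e q u : ℕ} (hε : ε = 1 ∨ ε = 5) (hpε : p % 6 = ε) (w : Fin 4 → ℕ)
    (hcount : ∀ j, Nat.count (IsExponent ε j) (w j + 1) = u + 1) (he : e = 4 * q + u)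
    (hw : ∑ j, w j = 6 * u) (hwp : ∀ j, 6 * q + w j ≤ p)
    (hep : ∀ j, 6 * e ≤ 6 * q + w j + 3 * p) :
    Nonempty (syz (gensDegree p e) (gens k p e) (gens_mem k p e) ≅
      ⨁ fun j => O k (-((6 * q + w j + 3 * p : ℕ) : ℤ))) := by
  have hex (j : Fin 4) : ∃ (A : Fin 4 → MvPolynomial (Fin 2) k) (B : MvPolynomial (Fin 2) k),
      (∀ y, (A y).IsHomogeneous (6 * q + w j)) ∧
      B.IsHomogeneous (6 * q + w j + 3 * p - 6 * e) ∧
      (∀ y, eval ![1, 0] (A y) = if y = j then 1 else 0) ∧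
      ∑ y : Fin 4, gens k p e y.castSucc * A y + sextic k ^ e * B = 0 := by
    have h : Nat.count (IsExponent ε j) (6 * q + w j + 1) = e + 1 := by
      rw [add_assoc, count_isExponent_add hε, hcount, he, add_assoc]
    obtain ⟨s, hs, hs'⟩ := exists_enum_isExponent j h
    choose i hi using fun x => (hs' x).2.2
    refine exists_syzygy j s hs (fun x => (hs' x).1) (fun x => (hs' x).2.1) (hwp j) i
      (fun x => ?_) (Nat.sub_add_cancel (hep j))
    have hp : p ≡ ε [MOD 6] := by
      rw [← hpε]; exact (Nat.mod_modEq p 6).symm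
    exact ((hp.mul_left _).add_left _).trans (Nat.ModEq.trans (hi x) (hp.mul_left _).symm)
  choose A B hA hB hAe hrel using hex
  refine syz_iso_of_independent (A := fun i j => A j i) (b := B) (fun i j => hA j i) hB
    (fun j => Nat.sub_add_cancel (hep j)) ?_ ?_ hrel
  · rw [Finset.sum_add_distrib, hw, he]
    simp
    ring
  · intro h
    have h₁ := congrArg (eval ![(1 : k), 0]) h
    have h₂ : (Matrix.of fun i j => A j i).map (eval ![(1 : k), 0]) = 1 := by
      ext i j
      exact (hAe j i).trans Matrix.one_apply.symm
    have h₃ := RingHom.map_det (eval ![(1 : k), 0]) (Matrix.of fun i j => A j i)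
    rw [RingHom.mapMatrix_apply, h₂, Matrix.det_one] at h₃
    rw [map_zero] at h₁
    exact one_ne_zero (h₃.symm.trans h₁)

/-- The splitting of the syzygy bundle, when `6 q + w j + 3 p` are the degrees of the generators
for a suitable order of the generators. -/
theorem syz_iso_of_count_rev {e q u : ℕ} (hp6 : p % 6 = 1 ∨ p % 6 = 5) (w : Fin 4 → ℕ)
    (hcount : ∀ j, Nat.count (IsExponent 1 j) (w j + 1) = u + 1)
    (hcount' : ∀ j, Nat.count (IsExponent 5 j) (w (Fin.rev j) + 1) = u + 1)
    (he : e = 4 * q + u)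
    (hw : ∑ j, w j = 6 * u) (hwp : ∀ j, 6 * q + w j ≤ p)
    (hep : ∀ j, 6 * e ≤ 6 * q + w j + 3 * p) :
    Nonempty (syz (gensDegree p e) (gens k p e) (gens_mem k p e) ≅
      ⨁ fun j => O k (-((6 * q + w j + 3 * p : ℕ) : ℤ))) := by
  obtain h | h := hp6
  · exact syz_iso_of_count (Or.inl rfl) h w hcount he hw hwp hep
  -- Since `5 ≡ -1` modulo 6, the residues change sign, which amounts to replacing `j` by `3 - j`.
  · obtain ⟨i⟩ := syz_iso_of_count (k := k) (Or.inr rfl) h (w ∘ Fin.rev) hcount' he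
      ((Equiv.sum_comp Fin.revPerm w).trans hw) (fun j => hwp _) (fun j => hep _)
    exact ⟨i ≪≫ biproduct.whiskerEquiv
      (g := fun j => O k (-((6 * q + w j + 3 * p : ℕ) : ℤ))) Fin.revPerm fun j => Iso.refl _⟩

end

/-! ### Regrouping direct sums. -/

section
open Limits

variable {C : Type*} [Category* C] [HasZeroMorphisms C] [HasFiniteBiproducts C]
  [HasBinaryBiproducts C]

/-- A direct sum indexed by a disjoint union. -/
noncomputable def biproductSumIso {I J : Type} [Finite I] [Finite J] (F : I ⊕ J → C) :
    (⨁ F) ≅ (⨁ fun i => F (Sum.inl i)) ⊞ ⨁ fun j => F (Sum.inr j) where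
  hom := biproduct.desc fun
    | Sum.inl i => biproduct.ι (fun i => F (Sum.inl i)) i ≫ biprod.inl
    | Sum.inr j => biproduct.ι (fun j => F (Sum.inr j)) j ≫ biprod.inr
  inv := biprod.desc (biproduct.desc fun i => biproduct.ι F (Sum.inl i))
    (biproduct.desc fun j => biproduct.ι F (Sum.inr j))
  hom_inv_id := by
    refine biproduct.hom_ext' _ _ fun x => ?_
    cases x <;> simp
  inv_hom_id := by
    refine biprod.hom_ext' _ _ ?_ ?_ <;> refine biproduct.hom_ext' _ _ fun x => ?_ <;> simp

/-- A direct sum with two types of summands. -/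
theorem biproduct_iso_of_sum {m n : ℕ} {ι : Type} [Finite ι] (φ : Fin m ⊕ Fin n ≃ ι) (F : ι → C)
    {a b : C} (ha : ∀ i, F (φ (Sum.inl i)) = a) (hb : ∀ i, F (φ (Sum.inr i)) = b) :
    Nonempty ((⨁ F) ≅ (⨁ fun _ : Fin m => a) ⊞ ⨁ fun _ : Fin n => b) :=
  ⟨(biproduct.whiskerEquiv (f := fun x => F (φ x)) φ fun _ => Iso.refl _).symm ≪≫
    biproductSumIso _ ≪≫
    biprod.mapIso (biproduct.mapIso fun i => eqToIso (ha i))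
      (biproduct.mapIso fun i => eqToIso (hb i))⟩

end

/-! ### The four splitting types, according to `e` modulo 4. -/

section
open Limits

variable {k : Type u} [Field k] {p : ℕ} [CharP k p] {e q : ℕ} {a b : ℤ}

/-- Here and in the next three lemmas, `w j` is the least bound for which `[0, w j]` contains `u +
1` exponents. For `p ≡ 1` modulo 6 the admissible residues for `j = 0, 1, 2, 3` are `{0,3,4,5}`,
`{0,1,4,5}`, `{0,1,2,5}` and `{0,1,2,3}`. -/
theorem syz_iso_four (hp6 : p % 6 = 1 ∨ p % 6 = 5) (he : e = 4 * q) (hqp : 6 * q ≤ p)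
    (hep : 6 * e ≤ 6 * q + 3 * p) (ha : a = -(6 * q + 3 * p)) :
    Nonempty (syz (gensDegree p e) (gens k p e) (gens_mem k p e) ≅ OSum k a 4) := by
  obtain ⟨i⟩ := syz_iso_of_count_rev (k := k) (u := 0) hp6 ![0, 0, 0, 0] (by decide) (by decide)
    he (by decide) (by intro j; fin_cases j <;> simpa using hqp)
    (by intro j; fin_cases j <;> simpa using hep)
  refine ⟨i ≪≫ biproduct.mapIso fun j => eqToIso (congrArg (O k) ?_)⟩
  fin_cases j <;> simp [ha]

theorem syz_iso_one_three (hp6 : p % 6 = 1 ∨ p % 6 = 5) (he : e = 4 * q + 1)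
    (hqp : 6 * q + 3 ≤ p) (hep : 6 * e ≤ 6 * q + 1 + 3 * p) (ha : a = -(6 * q + 3 + 3 * p))
    (hb : b = -(6 * q + 1 + 3 * p)) :
    Nonempty (syz (gensDegree p e) (gens k p e) (gens_mem k p e) ≅ O k a ⊞ OSum k b 3) := by
  obtain ⟨i⟩ := syz_iso_of_count_rev (k := k) (u := 1) hp6 ![3, 1, 1, 1] (by decide) (by decide)
    he (by decide) (by intro j; fin_cases j <;> simp <;> omega)
    (by intro j; fin_cases j <;> simp <;> omega)
  obtain ⟨i'⟩ := biproduct_iso_of_sum (finSumFinEquiv (m := 1) (n := 3))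
    (fun j => O k (-((6 * q + ![3, 1, 1, 1] j + 3 * p : ℕ) : ℤ))) (a := O k a) (b := O k b)
    (by intro j; fin_cases j; exact congrArg (O k) (by subst ha; push_cast; rfl))
    (by intro j; fin_cases j <;> exact congrArg (O k) (by subst hb; push_cast; rfl))
  exact ⟨i ≪≫ i' ≪≫ biprod.mapIso (biproductUniqueIso _) (Iso.refl _)⟩

theorem syz_iso_two_two (hp6 : p % 6 = 1 ∨ p % 6 = 5) (he : e = 4 * q + 2)
    (hqp : 6 * q + 4 ≤ p) (hep : 6 * e ≤ 6 * q + 2 + 3 * p) (ha : a = -(6 * q + 4 + 3 * p))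
    (hb : b = -(6 * q + 2 + 3 * p)) :
    Nonempty (syz (gensDegree p e) (gens k p e) (gens_mem k p e) ≅ OSum k a 2 ⊞ OSum k b 2) := by
  obtain ⟨i⟩ := syz_iso_of_count_rev (k := k) (u := 2) hp6 ![4, 4, 2, 2] (by decide) (by decide)
    he (by decide) (by intro j; fin_cases j <;> simp <;> omega)
    (by intro j; fin_cases j <;> simp <;> omega)
  obtain ⟨i'⟩ := biproduct_iso_of_sum (finSumFinEquiv (m := 2) (n := 2))
    (fun j => O k (-((6 * q + ![4, 4, 2, 2] j + 3 * p : ℕ) : ℤ))) (a := O k a) (b := O k b)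
    (by intro j; fin_cases j <;> exact congrArg (O k) (by subst ha; push_cast; rfl))
    (by intro j; fin_cases j <;> exact congrArg (O k) (by subst hb; push_cast; rfl))
  exact ⟨i ≪≫ i'⟩

theorem syz_iso_three_one (hp6 : p % 6 = 1 ∨ p % 6 = 5) (he : e = 4 * q + 3)
    (hqp : 6 * q + 5 ≤ p) (hep : 6 * e ≤ 6 * q + 3 + 3 * p) (ha : a = -(6 * q + 5 + 3 * p))
    (hb : b = -(6 * q + 3 + 3 * p)) :
    Nonempty (syz (gensDegree p e) (gens k p e) (gens_mem k p e) ≅ OSum k a 3 ⊞ O k b) := by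
  obtain ⟨i⟩ := syz_iso_of_count_rev (k := k) (u := 3) hp6 ![5, 5, 5, 3] (by decide) (by decide)
    he (by decide) (by intro j; fin_cases j <;> simp <;> omega)
    (by intro j; fin_cases j <;> simp <;> omega)
  obtain ⟨i'⟩ := biproduct_iso_of_sum (finSumFinEquiv (m := 3) (n := 1))
    (fun j => O k (-((6 * q + ![5, 5, 5, 3] j + 3 * p : ℕ) : ℤ))) (a := O k a) (b := O k b)
    (by intro j; fin_cases j <;> exact congrArg (O k) (by subst ha; push_cast; rfl))
    (by intro j; fin_cases j; exact congrArg (O k) (by subst hb; push_cast; rfl))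
  exact ⟨i ≪≫ i' ≪≫ biprod.mapIso (Iso.refl _) (biproductUniqueIso _)⟩

end

theorem mod_six_of_prime {p : ℕ} (h : p.Prime) (hp : 5 ≤ p) : p % 6 = 1 ∨ p % 6 = 5 := by
  have h2 : ¬ 2 ∣ p := fun h' => by
    have := (Nat.prime_dvd_prime_iff_eq Nat.prime_two h).1 h'
    omega
  have h3 : ¬ 3 ∣ p := fun h' => by
    have := (Nat.prime_dvd_prime_iff_eq Nat.prime_three h).1 h'
    omega
  omega

end ProjTwist

open CategoryTheory CategoryTheory.Limits ProjTwist in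
theorem proposition3p4 {k : Type*} [Field k] [IsAlgClosed k] (p : ℕ) [CharP k p] (hp : 5 ≤ p) :
    ((p : ℤ) ≡ 1 [ZMOD 8] →
      Nonempty (SPlus k p ≅ O k ((-15 * (p : ℤ) - 9) / 4) ⊞ OSum k ((-15 * (p : ℤ) - 1) / 4) 3) ∧
      Nonempty (SMinus k p ≅ OSum k ((-15 * (p : ℤ) + 3) / 4) 4)) ∧
    ((p : ℤ) ≡ -1 [ZMOD 8] →
      Nonempty (SPlus k p ≅ OSum k ((-15 * (p : ℤ) - 3) / 4) 4) ∧
      Nonempty (SMinus k p ≅ OSum k ((-15 * (p : ℤ) + 1) / 4) 3 ⊞ O k ((-15 * (p : ℤ) + 9) / 4))) ∧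
    ((p : ℤ) ≡ 3 [ZMOD 8] →
      Nonempty (SPlus k p ≅ OSum k ((-15 * (p : ℤ) - 7) / 4) 2 ⊞ OSum k ((-15 * (p : ℤ) + 1) / 4) 2) ∧
      Nonempty (SMinus k p ≅ O k ((-15 * (p : ℤ) - 3) / 4) ⊞ OSum k ((-15 * (p : ℤ) + 5) / 4) 3)) ∧
    ((p : ℤ) ≡ -3 [ZMOD 8] →
      Nonempty (SPlus k p ≅ OSum k ((-15 * (p : ℤ) - 5) / 4) 3 ⊞ O k ((-15 * (p : ℤ) + 3) / 4)) ∧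
      Nonempty (SMinus k p ≅ OSum k ((-15 * (p : ℤ) - 1) / 4) 2 ⊞ OSum k ((-15 * (p : ℤ) + 7) / 4) 2)) := by
  have hprime : p.Prime := (CharP.char_is_prime_or_zero k p).resolve_right (by omega)
  have hp6 := mod_six_of_prime hprime hp
  have hq (c : ℕ) (hc : c < 8) (h : (p : ℤ) ≡ c [ZMOD 8]) : ∃ q, p = 8 * q + c := by
    refine ⟨p / 8, ?_⟩
    unfold Int.ModEq at h
    omega
  refine ⟨fun h => ?_, fun h => ?_, fun h => ?_, fun h => ?_⟩
  -- For `p = 8 q + c` the exponents are `4 q + (c ± 1) / 2`, and their remainder modulo 4 selects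
  -- the lemma.
  · obtain ⟨q, rfl⟩ := hq 1 (by norm_num) h
    exact ⟨syz_iso_one_three (q := q) hp6 (by omega) (by omega) (by omega) (by omega) (by omega),
      syz_iso_four (q := q) hp6 (by omega) (by omega) (by omega) (by omega)⟩
  · obtain ⟨q, rfl⟩ := hq 7 (by norm_num) h
    -- Here `(p + 1) / 2 = 4 (q + 1)`, so a further full period appears.
    exact ⟨syz_iso_four (q := q + 1) hp6 (by omega) (by omega) (by omega) (by omega),
      syz_iso_three_one (q := q) hp6 (by omega) (by omega) (by omega) (by omega) (by omega)⟩
  · obtain ⟨q, rfl⟩ := hq 3 (by norm_num) h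
    exact ⟨syz_iso_two_two (q := q) hp6 (by omega) (by omega) (by omega) (by omega) (by omega),
      syz_iso_one_three (q := q) hp6 (by omega) (by omega) (by omega) (by omega) (by omega)⟩
  · obtain ⟨q, rfl⟩ := hq 5 (by norm_num) h
    exact ⟨syz_iso_three_one (q := q) hp6 (by omega) (by omega) (by omega) (by omega) (by omega),
      syz_iso_two_two (q := q) hp6 (by omega) (by omega) (by omega) (by omega) (by omega)⟩
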